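/- **Setup.** Let $K\ge 1$ and, for each action $a\in[K]=\{1,\dots,K\}$, let $f_{a,0}$ (pre-change) and $f_{a,1}$ (post-change) be probability densities with respect to a common measure $\lambda$. Write $\mathrm{LLR}(a,x)=\log\big(f_{a,1}(x)/f_{a,0}(x)\big)\in[-\infty,\infty]$ and $D_a=D(f_{a,1}\|f_{a,0})=\int \log(f_{a,1}/f_{a,0})\,f_{a,1}\,d\lambda$. Assume that $0<D_a<\infty$ for every $a$, and that there is a constant $v<\infty$ with $\log\int \exp\!\big(\theta(\mathrm{LLR}(a,x)-D_a)\big)f_{a,1}(x)\,d\lambda(x)\le \tfrac{v}{2}\theta^2$ for all $a\in[K]$ and $\theta\in\mathbb R$. For $\nu\in\{1,2,\dots\}\cup\{\infty\}$ and nonempty $\mathcal A\subseteq[K]$, under $\mathbb P_{\nu,\mathcal A}$ the observations $X_{a,n}$ ($a\in[K]$, $n\ge1$) are independent, with $X_{a,n}\sim f_{a,1}$ if $n\ge\nu$ and $a\in\mathcal A$, and $X_{a,n}\sim f_{a,0}$ otherwise; $\mathbb P_\infty$ is the law without a change. When the actions $A_1,A_2,\dots$ are taken, $\mathcal F_n=\sigma(X_{A_1,1},\dots,X_{A_n,n})$.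 **Control policy.** For an integer $W\ge1$, $A_{\mathrm{UCB}}=(A_n)_{n\ge1}$ is a UCB policy restarted every $W$ steps: $A_n$ is $\mathcal F_{n-1}$-measurable and $$A_n\in\operatorname*{argmax}_{a\in[K]}\Big(\hat\mu_a+\sqrt{4v\log W/N_a}\Big),$$ where $N_a$ is the number of times $m\le i<n$ with $A_i=a$, $m=(\lceil n/W\rceil-1)W+1$ being the start of the current interval, $\hat\mu_a$ is the average of $\mathrm{LLR}(a,X_{a,i})$ over these times, and the index is $+\infty$ if $N_a=0$. Ties are broken arbitrarily. **Detector.** One CuSum statistic is kept per action: $C_{a,0}=0$; $C_{a,n}=\max\{C_{a,n-1},0\}+\mathrm{LLR}(a,X_{a,n})$ if $A_n=a$, and $C_{a,n}=C_{a,n-1}$ otherwise. The alarm time is $\tilde T_b=\inf\{n\ge1: C_{a,n}\ge b\text{ for some }a\in[K]\}$. The worst-case delay is $$\mathcal J_{\mathcal A}=\sup_{\nu\ge1}\operatorname{ess\,sup}\,\mathbb E_{\nu,\mathcal A}\big[(\tilde T_b-\nu+1)^+\,\big|\,\mathcal F_{\nu-1}\big],$$ and $I_{\mathcal A}=\max_{a\in\mathcal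 A}D_a$. **Theorem 2 (asymptotic optimality of PA-UCB-CuSum).** Let $b=\log\gamma$ with $\gamma>0$. (i) For every $W\ge1$ and $\gamma>0$, $\mathbb E_\infty[\tilde T_b]\ge\gamma$. (ii) Let $\mathcal A\subseteq[K]$ be nonempty, and suppose that the maximum $I_{\mathcal A}=\max_{a\in\mathcal A}D_a$ is attained at a single action $a^*\in\mathcal A$. Then, as $\gamma,W\to\infty$ with $W=o(\log\gamma)$, $$\mathcal J_{\mathcal A}\big(A_{\mathrm{UCB}},\tilde T_b\big)\le\frac{\log\gamma}{I_{\mathcal A}}\,(1+o(1)).$$ -/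

import Mathlib

open MeasureTheory ProbabilityTheory Filter Topology
open scoped ENNReal NNReal

/-- The data of a multichannel bandit quickest change detection problem with `K` channels and
observations in `𝓧`: for each action `a`, a pre-change density `f₀ a` and a post-change density
`f₁ a` with respect to a common dominating measure `lam`. -/
structure BanditQCD (K : ℕ) (𝓧 : Type*) [MeasurableSpace 𝓧] where
  /-- the dominating measure -/
  lam : Measure 𝓧
  /-- the pre-change densities -/
  f₀ : Fin K → 𝓧 → ℝ≥0∞
  /-- the post-change densities -/
  f₁ : Fin K → 𝓧 → ℝ≥0∞
  measurable_f₀ : ∀ a, Measurable (f₀ a)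
  measurable_f₁ : ∀ a, Measurable (f₁ a)
  lintegral_f₀ : ∀ a, ∫⁻ x, f₀ a x ∂lam = 1
  lintegral_f₁ : ∀ a, ∫⁻ x, f₁ a x ∂lam = 1

namespace BanditQCD

noncomputable section

variable {K : ℕ} {𝓧 : Type*} [MeasurableSpace 𝓧] (M : BanditQCD K 𝓧)

/-- The pre-change law of a single observation of channel `a`. -/
def pre (a : Fin K) : Measure 𝓧 := M.lam.withDensity (M.f₀ a)

/-- The post-change law of a single observation of channel `a`. -/
def post (a : Fin K) : Measure 𝓧 := M.lam.withDensity (M.f₁ a)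

instance isProbabilityMeasure_pre (a : Fin K) : IsProbabilityMeasure (M.pre a) :=
  ⟨by rw [pre, withDensity_apply _ MeasurableSet.univ]; simpa using M.lintegral_f₀ a⟩

instance isProbabilityMeasure_post (a : Fin K) : IsProbabilityMeasure (M.post a) :=
  ⟨by rw [post, withDensity_apply _ MeasurableSet.univ]; simpa using M.lintegral_f₁ a⟩

/-- The log-likelihood ratio `log (f₁ a x / f₀ a x)`, with values in `[-∞, ∞]`
(it is `-∞` where `f₁ a x = 0 < f₀ a x`). -/
def LLR (a : Fin K) (x : 𝓧) : EReal := ENNReal.log (M.f₁ a x / M.f₀ a x)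

/-- The Kullback-Leibler divergence `∫ log (f₁ a / f₀ a) * f₁ a ∂lam`. It is used for models
satisfying `Regular` only, where the log-likelihood ratio is finite almost everywhere under the
post-change law and integrable. -/
def KL (a : Fin K) : ℝ := ∫ x, (M.LLR a x).toReal ∂(M.post a)

/-- The standing assumption on the densities: the divergences are finite and positive, and the
log-likelihood ratios are `v`-sub-Gaussian under the post-change laws. The first field is part of
the finiteness of the divergence; the rest of it (integrability) follows from the third field. -/
structure Regular (v : ℝ≥0) : Prop where
  ac : ∀ a, M.post a ≪ M.pre a
  KL_pos : ∀ a, 0 < M.KL a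
  subGaussian : ∀ a, HasSubgaussianMGF (fun x => (M.LLR a x).toReal - M.KL a) v (M.post a)

/-- The sample space: `ω n a` is the observation `X_{a,n}` of channel `a` at time `n`. Time steps
are `n = 1, 2, …`; the coordinate `ω 0` is never used. -/
abbrev Path (K : ℕ) (𝓧 : Type*) : Type _ := ℕ → Fin K → 𝓧

/-- The law of `X_{a,n}` when the actions in `𝒜` change at time `ν` (`ν = ⊤`: no change). -/
def obsLaw (ν : ℕ∞) (𝒜 : Finset (Fin K)) (n : ℕ) (a : Fin K) : Measure 𝓧 :=
  if ν ≤ n ∧ a ∈ 𝒜 then M.post a else M.pre a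

instance isProbabilityMeasure_obsLaw (ν : ℕ∞) (𝒜 : Finset (Fin K)) (n : ℕ) (a : Fin K) :
    IsProbabilityMeasure (M.obsLaw ν 𝒜 n a) := by
  unfold obsLaw; split_ifs <;> infer_instance

/-- `ℙ_{ν,𝒜}`: all observations are independent, and the actions in `𝒜` change at time `ν`. -/
def law (ν : ℕ∞) (𝒜 : Finset (Fin K)) : Measure (Path K 𝓧) :=
  Measure.infinitePi fun n : ℕ => Measure.pi fun a : Fin K => M.obsLaw ν 𝒜 n a

/-- `ℙ_∞`: no change ever occurs. -/
def lawNoChange : Measure (Path K 𝓧) := M.law ⊤ ∅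

/-- `𝓕_n = σ(X_{A_1,1}, …, X_{A_n,n})`, the information collected up to time `n` when the actions
are chosen by `A`. -/
abbrev history (A : ℕ → Path K 𝓧 → Fin K) (n : ℕ) : MeasurableSpace (Path K 𝓧) :=
  ⨆ i ∈ Finset.Icc 1 n,
    MeasurableSpace.comap (fun ω : Path K 𝓧 => ω i (A i ω)) inferInstance

/-- Control policies: the action at time `n` is a function of the observations made before. -/
def IsControlPolicy (A : ℕ → Path K 𝓧 → Fin K) : Prop :=
  ∀ n, 1 ≤ n → Measurable[history A (n - 1)] (A n)

/-- The first time step of the interval of length `W` that contains time `n ≥ 1`, that is,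
`(⌈n / W⌉ - 1) * W + 1`. -/
def windowStart (W n : ℕ) : ℕ := (n - 1) / W * W + 1

/-- The number of times action `a` has been selected in the current interval before time `n`. -/
def pulls (A : ℕ → Path K 𝓧 → Fin K) (W : ℕ) (a : Fin K) (n : ℕ) (ω : Path K 𝓧) : ℕ :=
  ((Finset.Ico (windowStart W n) n).filter fun i => A i ω = a).card

/-- The empirical mean of the rewards of action `a` in the current interval before time `n`
(used only when there is at least one such reward). -/
def meanReward (A : ℕ → Path K 𝓧 → Fin K) (W : ℕ) (a : Fin K) (n : ℕ) (ω : Path K 𝓧) : EReal :=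
  (∑ i ∈ (Finset.Ico (windowStart W n) n).filter (fun i => A i ω = a), M.LLR a (ω i a)) /
    ((pulls A W a n ω : ℝ) : EReal)

/-- The UCB index of action `a` with which the action at time `n` is chosen; it is `∞` if `a` has
not been selected yet in the current interval. -/
def ucbIndex (v : ℝ≥0) (A : ℕ → Path K 𝓧 → Fin K) (W : ℕ) (a : Fin K) (n : ℕ) (ω : Path K 𝓧) :
    EReal :=
  if pulls A W a n ω = 0 then ⊤
  else M.meanReward A W a n ω +
    ((Real.sqrt (4 * (v : ℝ) * Real.log W / (pulls A W a n ω : ℝ)) : ℝ) : EReal)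

/-- `A` is a UCB control policy restarted every `W` time steps: at each time it selects an action
of maximal UCB index (ties being broken in any way based on the past observations). -/
structure IsUCBPolicy (v : ℝ≥0) (W : ℕ) (A : ℕ → Path K 𝓧 → Fin K) : Prop where
  isControlPolicy : IsControlPolicy A
  argmax : ∀ n, 1 ≤ n → ∀ ω a, M.ucbIndex v A W a n ω ≤ M.ucbIndex v A W (A n ω) n ω

/-- The per-action CuSum statistic `C_{a,n}` under the policy `A`. -/
def cusum (A : ℕ → Path K 𝓧 → Fin K) (a : Fin K) : ℕ → Path K 𝓧 → EReal
  | 0, _ => 0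
  | n + 1, ω =>
    if A (n + 1) ω = a then max (cusum A a n ω) 0 + M.LLR a (ω (n + 1) a)
    else cusum A a n ω

/-- The first time `n ≥ 1` at which one of the per-action CuSum statistics reaches the threshold
`b` (`⊤` if there is none). -/
def alarm (A : ℕ → Path K 𝓧 → Fin K) (b : ℝ) (ω : Path K 𝓧) : ℕ∞ :=
  sInf {t : ℕ∞ | ∃ n : ℕ, 1 ≤ n ∧ (∃ a, (b : EReal) ≤ M.cusum A a n ω) ∧ t = n}

/-- The mean time to false alarm `𝔼_∞[T]`. -/
def meanTimeToFalseAlarm (T : Path K 𝓧 → ℕ∞) : ℝ≥0∞ :=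
  ∫⁻ ω, ((T ω : ℕ∞) : ℝ≥0∞) ∂M.lawNoChange

/-- Lorden's worst-case expected detection delay
`sup_{ν ≥ 1} ess sup 𝔼_{ν,𝒜}[(T - ν + 1)⁺ | 𝓕_{ν-1}]`. -/
def worstCaseDelay (𝒜 : Finset (Fin K)) (A : ℕ → Path K 𝓧 → Fin K) (T : Path K 𝓧 → ℕ∞) : ℝ≥0∞ :=
  ⨆ (ν : ℕ) (_ : 1 ≤ ν),
    essSup (condLExp (history A (ν - 1)) (M.law ν 𝒜)
      (fun ω => ((T ω + 1 - (ν : ℕ∞) : ℕ∞) : ℝ≥0∞))) (M.law ν 𝒜)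

/-- `I_𝒜`, the largest divergence among the affected actions. -/
def maxKL (𝒜 : Finset (Fin K)) (h𝒜 : 𝒜.Nonempty) : ℝ := 𝒜.sup' h𝒜 M.KL

end

end BanditQCD

/-!
The exponential of a CuSum statistic is at most the maximum of `1` and the Shiryaev-Roberts
statistic of the same action. Without a change, the sum of the latter over the actions grows by at
most one per step in conditional expectation, and it is at least `exp b` when the alarm with
threshold `b > 0` is raised, so optional stopping gives `exp b ≤ 𝔼_∞[T]` for every control policy.

For the delay, fix an interval that starts after the change. Whatever happened before it, Chernoff
bounds at exponent `2 log W` show that the UCB rule selects each action other than the best affected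
one only `O(log W)` times on average. Hence the log-likelihood ratios of the best action, truncated
from above at `B`, have a drift of about `W * I` per interval. Until the alarm their sum is at most
`b`, apart from the last interval, whose contribution truncation bounds by `B * W`. Comparing the
two, as in Wald's identity, bounds the mean number of intervals before the alarm by
`(b + B * W) / (W * I)`, up to a factor tending to `1`.
-/

theorem tsum_ite_natCast_lt (t : ℕ∞) :
    ∑' n : ℕ, (if (n : ℕ∞) < t then (1 : ℝ≥0∞) else 0) = t := by
  induction t using ENat.recTopCoe with
  | top => simp
  | coe t =>
    rw [tsum_eq_sum (s := Finset.range t) fun n hn => by simpa using hn]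
    simp [Finset.filter_true_of_mem fun _ => Finset.mem_range.1]

section Stopping

variable {Ω : Type*} [MeasurableSpace Ω] {μ : Measure Ω} {T : Ω → ℕ∞}

theorem lintegral_natCast_eq_tsum_measure_lt (hT : ∀ n : ℕ, MeasurableSet {ω | (n : ℕ∞) < T ω}) :
    ∫⁻ ω, (T ω : ℝ≥0∞) ∂μ = ∑' n : ℕ, μ {ω | (n : ℕ∞) < T ω} := by
  simp_rw [← tsum_ite_natCast_lt]
  rw [lintegral_tsum fun n =>
    (Measurable.ite (hT n) measurable_const measurable_const).aemeasurable]
  refine tsum_congr fun n => ?_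
  rw [← lintegral_indicator_one (hT n)]
  simp only [Set.indicator_apply, Set.mem_ofPred_eq, Pi.one_apply]

theorem lintegral_stopped_le_lintegral (hT : ∀ n : ℕ, MeasurableSet {ω | (n : ℕ∞) < T ω})
    {S : ℕ → Ω → ℝ≥0∞} (hS₀ : S 0 = 0)
    (hS : ∀ n : ℕ, ∫⁻ ω in {ω | (n : ℕ∞) < T ω}, S (n + 1) ω ∂μ
      ≤ μ {ω | (n : ℕ∞) < T ω} + ∫⁻ ω in {ω | (n : ℕ∞) < T ω}, S n ω ∂μ) (m : ℕ) :
    ∫⁻ ω, S (min (m : ℕ∞) (T ω)).toNat ω ∂μ ≤ ∫⁻ ω, (T ω : ℝ≥0∞) ∂μ := by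
  have hle : ∫⁻ ω, S (min (m : ℕ∞) (T ω)).toNat ω ∂μ
      ≤ ∑ n ∈ Finset.range m, μ {ω | (n : ℕ∞) < T ω} := by
    induction m with
    | zero => simp [hS₀]
    | succ m ih =>
      set B := {ω | (m : ℕ∞) < T ω}
      have hbefore : ∫⁻ ω in B, S (min ((m + 1 : ℕ) : ℕ∞) (T ω)).toNat ω ∂μ
          ≤ μ B + ∫⁻ ω in B, S (min (m : ℕ∞) (T ω)).toNat ω ∂μ := by
        have hsucc : ∫⁻ ω in B, S (min ((m + 1 : ℕ) : ℕ∞) (T ω)).toNat ω ∂μ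
            = ∫⁻ ω in B, S (m + 1) ω ∂μ := setLIntegral_congr_fun (hT m) fun ω hω => by
          have hω : ((m + 1 : ℕ) : ℕ∞) ≤ T ω := by
            exact_mod_cast Order.add_one_le_of_lt (show (m : ℕ∞) < T ω from hω)
          rw [min_eq_left hω, ENat.toNat_natCast]
        have hcur : ∫⁻ ω in B, S (min (m : ℕ∞) (T ω)).toNat ω ∂μ = ∫⁻ ω in B, S m ω ∂μ :=
          setLIntegral_congr_fun (hT m) fun ω hω => by
            rw [min_eq_left (le_of_lt hω), ENat.toNat_natCast]
        rw [hsucc, hcur]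
        exact hS m
      have hafter : ∫⁻ ω in Bᶜ, S (min ((m + 1 : ℕ) : ℕ∞) (T ω)).toNat ω ∂μ
          = ∫⁻ ω in Bᶜ, S (min (m : ℕ∞) (T ω)).toNat ω ∂μ := by
        refine setLIntegral_congr_fun (hT m).compl fun ω hω => ?_
        have hω : T ω ≤ m := not_lt.1 hω
        rw [min_eq_right hω, min_eq_right (hω.trans (by exact_mod_cast m.le_succ))]
      rw [Finset.sum_range_succ, ← lintegral_add_compl _ (hT m), hafter]
      calc _ ≤ μ B + ∫⁻ ω in B, S (min (m : ℕ∞) (T ω)).toNat ω ∂μ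
            + ∫⁻ ω in Bᶜ, S (min (m : ℕ∞) (T ω)).toNat ω ∂μ := by gcongr
        _ = ∫⁻ ω, S (min (m : ℕ∞) (T ω)).toNat ω ∂μ + μ B := by
            rw [add_assoc, lintegral_add_compl _ (hT m), add_comm]
        _ ≤ _ := by gcongr
  exact hle.trans (lintegral_natCast_eq_tsum_measure_lt hT ▸ ENNReal.sum_le_tsum _)

theorem le_lintegral_of_forall_stopped_ge [IsProbabilityMeasure μ]
    (hT : ∀ n : ℕ, MeasurableSet {ω | (n : ℕ∞) < T ω}) {S : ℕ → Ω → ℝ≥0∞} (hS₀ : S 0 = 0)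
    (hS : ∀ n : ℕ, ∫⁻ ω in {ω | (n : ℕ∞) < T ω}, S (n + 1) ω ∂μ
      ≤ μ {ω | (n : ℕ∞) < T ω} + ∫⁻ ω in {ω | (n : ℕ∞) < T ω}, S n ω ∂μ)
    {c : ℝ≥0∞} (hc : ∀ (n : ℕ) (ω : Ω), T ω = n → c ≤ S n ω) :
    c ≤ ∫⁻ ω, (T ω : ℝ≥0∞) ∂μ := by
  by_cases htop : ∫⁻ ω, (T ω : ℝ≥0∞) ∂μ = ⊤
  · simp [htop]
  have hmeas : Measurable fun ω => (T ω : ℝ≥0∞) := by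
    simp_rw [← tsum_ite_natCast_lt]
    exact Measurable.tsum fun n => Measurable.ite (hT n) measurable_const measurable_const
  have hfin : ∀ᵐ ω ∂μ, ω ∈ ⋃ m : ℕ, {ω | T ω ≤ (m : ℕ∞)} := by
    filter_upwards [ae_lt_top hmeas htop] with ω hω
    rw [ENat.toENNReal_lt_top] at hω
    exact Set.mem_iUnion.2 ⟨(T ω).toNat, (ENat.natCast_toNat hω.ne).ge⟩
  have hTm (m : ℕ) : MeasurableSet {ω | T ω ≤ (m : ℕ∞)} := by
    simpa only [Set.compl_ofPred, not_lt] using (hT m).compl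
  have hmono : Monotone fun m : ℕ => {ω | T ω ≤ (m : ℕ∞)} := fun i j hij ω hω =>
    le_trans (show T ω ≤ i from hω) (by exact_mod_cast hij)
  calc c = ⨆ m : ℕ, c * μ {ω | T ω ≤ (m : ℕ∞)} := by
        rw [← ENNReal.mul_iSup, ← hmono.measure_iUnion,
          (mem_ae_iff_prob_eq_one (.iUnion hTm)).1 hfin, mul_one]
    _ ≤ _ := iSup_le fun m => ?_
  calc c * μ {ω | T ω ≤ (m : ℕ∞)}
      ≤ ∫⁻ ω in {ω | T ω ≤ (m : ℕ∞)}, S (min (m : ℕ∞) (T ω)).toNat ω ∂μ := by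
        rw [← setLIntegral_const]
        refine setLIntegral_mono' (hTm m) fun ω hω => ?_
        rw [min_eq_right hω]
        exact hc _ ω (ENat.natCast_toNat (ne_top_of_le_ne_top (ENat.natCast_ne_top m) hω)).symm
    _ ≤ ∫⁻ ω, S (min (m : ℕ∞) (T ω)).toNat ω ∂μ := setLIntegral_le_lintegral _ _
    _ ≤ _ := lintegral_stopped_le_lintegral hT hS₀ hS m

end Stopping

theorem ae_withDensity_ne_zero_and_ne_top {α : Type*} [MeasurableSpace α] {μ : Measure α}
    {f : α → ℝ≥0∞} (hf : Measurable f) (hfi : ∫⁻ x, f x ∂μ ≠ ⊤) :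
    ∀ᵐ x ∂(μ.withDensity f), f x ≠ 0 ∧ f x ≠ ⊤ :=
  ((ae_withDensity_iff hf).2 (ae_of_all _ fun _ h => h)).and
    ((withDensity_absolutelyContinuous μ f).ae_le ((ae_lt_top hf hfi).mono fun _ h => h.ne))

theorem ereal_exp_sum {ι : Type*} (s : Finset ι) (f : ι → EReal) :
    (∑ i ∈ s, f i).exp = ∏ i ∈ s, (f i).exp := by
  classical
  induction s using Finset.induction_on with
  | empty => simp
  | insert a s ha ih => rw [Finset.sum_insert ha, Finset.prod_insert ha, EReal.exp_add, ih]

theorem ofReal_exp_mul_ofReal_exp (x y : ℝ) :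
    ENNReal.ofReal (Real.exp x) * ENNReal.ofReal (Real.exp y)
      = ENNReal.ofReal (Real.exp (x + y)) := by
  rw [← ENNReal.ofReal_mul (Real.exp_pos x).le, ← Real.exp_add]

theorem le_ofReal_exp_neg_mul {x : ℝ} {p q : ℝ≥0∞} (h : ENNReal.ofReal (Real.exp x) * p ≤ q) :
    p ≤ ENNReal.ofReal (Real.exp (-x)) * q :=
  calc p = ENNReal.ofReal (Real.exp (-x)) * (ENNReal.ofReal (Real.exp x) * p) := by
        rw [← mul_assoc, ofReal_exp_mul_ofReal_exp, neg_add_cancel, Real.exp_zero,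
          ENNReal.ofReal_one, one_mul]
    _ ≤ _ := by gcongr

theorem card_filter_and_card_filter_lt_le (p : ℕ → Prop) [DecidablePred p] (s n k : ℕ) :
    ((Finset.Ico s n).filter fun i => p i ∧ ((Finset.Ico s i).filter p).card < k).card ≤ k := by
  suffices h : ((Finset.Ico s n).filter fun i => p i ∧ ((Finset.Ico s i).filter p).card < k).card
      ≤ min k ((Finset.Ico s n).filter p).card from h.trans (min_le_left _ _)
  induction n with
  | zero => simp
  | succ n ih =>
    rcases lt_or_ge n s with h | h
    · simp [Finset.Ico_eq_empty_of_le (show n + 1 ≤ s from h)]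
    · rw [← Finset.insert_Ico_right_eq_Ico_add_one h, Finset.filter_insert, Finset.filter_insert]
      grind [Finset.card_insert_of_notMem]

-- The constant `4` of the index is tuned to the exponent `2 log W`: a union bound over the at most
-- `W` possible numbers of pulls then leaves probability `1 / W`.
theorem exists_chernoff_exponent (v : ℝ≥0) {L ε : ℝ} (hL : 0 ≤ L) (hε : 0 < ε) {k : ℕ}
    (hk : 1 ≤ k) :
    ∃ t : ℝ, 0 ≤ t ∧ 2 * L ≤ t * k * (ε + Real.sqrt (4 * v * L / k) - v * t / 2) := by
  have : (0 : ℝ) < k := by exact_mod_cast hk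
  rcases eq_or_ne v 0 with rfl | hv
  · refine ⟨2 * L / ε, by positivity, ?_⟩
    have hk1 : L * 1 ≤ L * k := by gcongr; exact_mod_cast hk
    have hcancel : 2 * L / ε * k * ε = 2 * (L * k) := by field_simp
    simp only [NNReal.coe_zero, mul_zero, zero_mul, zero_div, Real.sqrt_zero, add_zero, sub_zero,
      hcancel]
    linarith
  · set s := Real.sqrt (4 * v * L / k)
    have : (0 : ℝ) < v := by exact_mod_cast pos_iff_ne_zero.2 hv
    have hs : s ^ 2 = 4 * v * L / k := Real.sq_sqrt (by positivity)
    refine ⟨s / v, by positivity, ?_⟩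
    calc 2 * L = k * s ^ 2 / v / 2 := by rw [hs]; field_simp; ring
      _ ≤ s / v * k * ε + k * s ^ 2 / v / 2 := le_add_of_nonneg_left (by positivity)
      _ = s / v * k * (ε + s - v * (s / v) / 2) := by field_simp; ring

theorem measure_inter_le_inv_of_subset_iUnion {Ω : Type*} [MeasurableSpace Ω] (μ : Measure Ω)
    {W k₀ : ℕ} (hk₀ : 1 ≤ k₀) {E F : Set Ω} {G : ℕ → Set Ω}
    (hF : F ⊆ ⋃ k ∈ Finset.Icc k₀ W, G k)
    (hG : ∀ k, k₀ ≤ k → μ (E ∩ G k) ≤ ENNReal.ofReal (Real.exp (-(2 * Real.log W))) * μ E) :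
    μ (E ∩ F) ≤ (W : ℝ≥0∞)⁻¹ * μ E := by
  have hexp : (W : ℝ≥0∞) * ENNReal.ofReal (Real.exp (-(2 * Real.log W))) ≤ (W : ℝ≥0∞)⁻¹ := by
    rcases W.eq_zero_or_pos with rfl | hW
    · simp
    have hW' : (0 : ℝ) < W := by exact_mod_cast hW
    rw [← ENNReal.ofReal_natCast, ← ENNReal.ofReal_mul hW'.le, ← ENNReal.ofReal_inv_of_pos hW',
      Real.exp_neg, two_mul, Real.exp_add, Real.exp_log hW']
    gcongr
    field_simp
    rfl
  calc μ (E ∩ F) ≤ μ (⋃ k ∈ Finset.Icc k₀ W, E ∩ G k) := by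
        simp only [← Set.inter_iUnion]
        exact measure_mono (Set.inter_subset_inter_right E hF)
    _ ≤ ∑ k ∈ Finset.Icc k₀ W, μ (E ∩ G k) := measure_biUnion_finset_le _ _
    _ ≤ ∑ _k ∈ Finset.Icc k₀ W, ENNReal.ofReal (Real.exp (-(2 * Real.log W))) * μ E :=
        Finset.sum_le_sum fun k hk => hG k (Finset.mem_Icc.1 hk).1
    _ ≤ W * (ENNReal.ofReal (Real.exp (-(2 * Real.log W))) * μ E) := by
        rw [Finset.sum_const, nsmul_eq_mul, Nat.card_Icc]
        gcongr
        omega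
    _ ≤ _ := by rw [← mul_assoc]; gcongr

theorem tsum_le_mul_tsum_mul_of_antitone {f : ℕ → ℝ≥0∞} (hf : Antitone f) {W : ℕ} (hW : 1 ≤ W) :
    ∑' n, f n ≤ W * ∑' j, f (j * W) := by
  have : NeZero W := ⟨by omega⟩
  calc ∑' n, f n ≤ ∑' n, f (n / W * W) :=
        ENNReal.tsum_le_tsum fun n => hf (Nat.div_mul_le_self n W)
    _ = ∑' p : ℕ × Fin W, f (p.1 * W) := (Nat.divModEquiv W).tsum_eq fun p => f (p.1 * W)
    _ = W * ∑' j, f (j * W) := by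
        rw [ENNReal.tsum_prod (f := fun j (_ : Fin W) => f (j * W)), ← ENNReal.tsum_mul_left]
        simp

theorem lintegral_delay_le {Ω : Type*} [MeasurableSpace Ω] (μ : Measure Ω) {T : Ω → ℕ∞}
    (hT : ∀ n : ℕ, MeasurableSet {ω | (n : ℕ∞) < T ω}) {W m ν : ℕ} (hW : 1 ≤ W)
    (hm : m + 1 ≤ ν + W) :
    ∫⁻ ω, ((T ω + 1 - ν : ℕ∞) : ℝ≥0∞) ∂μ
      ≤ W * μ Set.univ + W * ∑' j : ℕ, μ {ω | ((m + j * W : ℕ) : ℕ∞) < T ω} := by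
  have hsub (n : ℕ) : {ω | (n : ℕ∞) < T ω - m} = {ω | ((m + n : ℕ) : ℕ∞) < T ω} := by
    ext ω
    simp only [Set.mem_ofPred_eq, Nat.cast_add, lt_tsub_iff_left]
  have hle (ω : Ω) : T ω + 1 - ν ≤ W + (T ω - m) := by
    rw [tsub_le_iff_right]
    calc T ω + 1 ≤ T ω - m + m + 1 := by gcongr; exact le_tsub_add
      _ = T ω - m + ((m + 1 : ℕ) : ℕ∞) := by push_cast; ring
      _ ≤ T ω - m + ((ν + W : ℕ) : ℕ∞) := by gcongr
      _ = W + (T ω - m) + ν := by push_cast; ring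
  calc ∫⁻ ω, ((T ω + 1 - ν : ℕ∞) : ℝ≥0∞) ∂μ
      ≤ ∫⁻ ω, ((W : ℝ≥0∞) + ((T ω - m : ℕ∞) : ℝ≥0∞)) ∂μ :=
        lintegral_mono fun ω => by simpa using ENat.toENNReal_le.2 (hle ω)
    _ = W * μ Set.univ + ∑' n : ℕ, μ {ω | (n : ℕ∞) < T ω - m} := by
        rw [lintegral_add_left measurable_const, lintegral_const,
          lintegral_natCast_eq_tsum_measure_lt fun n => by rw [hsub]; exact hT _]
    _ ≤ _ := by
        simp only [hsub]
        gcongr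
        refine tsum_le_mul_tsum_mul_of_antitone (f := fun n => μ {ω | ((m + n : ℕ) : ℕ∞) < T ω})
          (fun i j hij => measure_mono fun ω (hω : ((m + j : ℕ) : ℕ∞) < T ω) => hω.trans_le' ?_) hW
        exact_mod_cast Nat.add_le_add_left hij m

theorem tsum_measure_le_of_le_setIntegral {Ω : Type*} [MeasurableSpace Ω] {μ : Measure Ω}
    [IsFiniteMeasure μ] {G : ℕ → Set Ω} (hG : ∀ j, MeasurableSet (G j)) {ξ : ℕ → Ω → ℝ}
    (hξ : ∀ j, Integrable (ξ j) μ) {c d : ℝ} (hc : 0 < c)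
    (hdrift : ∀ j, c * μ.real (G j) ≤ ∫ ω in G j, ξ j ω ∂μ)
    (hbound : ∀ J : ℕ, ∀ᵐ ω ∂μ, ∑ j ∈ Finset.range J, (G j).indicator (ξ j) ω ≤ d) :
    ∑' j, μ (G j) ≤ ENNReal.ofReal (d / c) * μ Set.univ := by
  refine ENNReal.tsum_le_of_sum_range_le fun J => ?_
  have hsum : c * ∑ j ∈ Finset.range J, μ.real (G j) ≤ d * μ.real Set.univ :=
    calc c * ∑ j ∈ Finset.range J, μ.real (G j)
        ≤ ∑ j ∈ Finset.range J, ∫ ω, (G j).indicator (ξ j) ω ∂μ := by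
          rw [Finset.mul_sum]
          refine Finset.sum_le_sum fun j _ => (hdrift j).trans_eq ?_
          rw [integral_indicator (hG j)]
      _ = ∫ ω, ∑ j ∈ Finset.range J, (G j).indicator (ξ j) ω ∂μ :=
          (integral_finsetSum _ fun j _ => (hξ j).indicator (hG j)).symm
      _ ≤ ∫ _, d ∂μ := integral_mono_ae
          (integrable_finsetSum _ fun j _ => (hξ j).indicator (hG j)) (integrable_const d)
          (hbound J)
      _ = d * μ.real Set.univ := by rw [integral_const, smul_eq_mul, mul_comm]
  calc ∑ j ∈ Finset.range J, μ (G j)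
      = ENNReal.ofReal (∑ j ∈ Finset.range J, μ.real (G j)) := by
        rw [ENNReal.ofReal_sum_of_nonneg fun _ _ => measureReal_nonneg]
        exact Finset.sum_congr rfl fun j _ => (ofReal_measureReal (s := G j)).symm
    _ ≤ ENNReal.ofReal (d / c * μ.real Set.univ) := by
        gcongr
        rw [div_mul_eq_mul_div, le_div_iff₀' hc]
        exact hsum
    _ = ENNReal.ofReal (d / c) * μ Set.univ := by
        rw [ENNReal.ofReal_mul' measureReal_nonneg, ofReal_measureReal]

theorem exists_lt_integral_min {α : Type*} [MeasurableSpace α] {μ : Measure α} {f : α → ℝ}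
    (hf : Integrable f μ) {y : ℝ} (hy : y < ∫ x, f x ∂μ) :
    ∃ B : ℝ, 0 ≤ B ∧ y < ∫ x, min (f x) B ∂μ := by
  have hlim : Tendsto (fun n : ℕ => ∫ x, min (f x) n ∂μ) atTop (𝓝 (∫ x, f x ∂μ)) := by
    refine tendsto_integral_of_dominated_convergence (fun x => |f x|)
      (fun n => hf.aestronglyMeasurable.inf aestronglyMeasurable_const) hf.abs
      (fun n => ae_of_all _ fun x => ?_) (ae_of_all _ fun x => ?_)
    · rw [Real.norm_eq_abs]
      rcases le_total (f x) n with h | h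
      · rw [min_eq_left h]
      · rw [min_eq_right h, Nat.abs_cast]
        exact h.trans (le_abs_self _)
    · refine tendsto_const_nhds.congr' ?_
      filter_upwards [eventually_ge_atTop ⌈f x⌉₊] with n hn
      exact (min_eq_left ((Nat.le_ceil _).trans (by exact_mod_cast hn))).symm
  obtain ⟨n, hn⟩ := (hlim.eventually_const_lt hy).exists
  exact ⟨n, n.cast_nonneg, hn⟩

theorem eventually_mul_le_sub_log_mul (C : ℝ) {y μ : ℝ} (hμ : 0 < μ) (hy : y < μ) :
    ∀ᶠ w : ℕ in atTop, w * y ≤ (w - C * (Real.log w + 1)) * μ := by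
  have hlog : (fun w : ℝ => C * (Real.log w + 1)) =o[atTop] fun w : ℝ => w :=
    (Real.isLittleO_log_id_atTop.add
      (Asymptotics.isLittleO_const_id_atTop (1 : ℝ))).const_mul_left C
  have hgap : 0 < (μ - y) / μ := div_pos (sub_pos.2 hy) hμ
  filter_upwards [(hlog.def hgap).natCast_atTop] with w hw
  have hw' : C * (Real.log w + 1) ≤ (μ - y) / μ * w := by
    simpa using (le_abs_self _).trans hw
  rw [div_mul_eq_mul_div, le_div_iff₀ hμ] at hw'
  linarith

theorem exists_tendsto_zero_le_ofReal {ι : Type*} {l : Filter ι} {J : ι → ℝ≥0∞} {c : ι → ℝ}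
    (hc : ∀ᶠ i in l, 0 < c i)
    (h : ∀ η : ℝ, 0 < η → ∀ᶠ i in l, J i ≤ ENNReal.ofReal (c i * (1 + η))) :
    ∃ r : ι → ℝ, Tendsto r l (𝓝 0) ∧ ∀ᶠ i in l, J i ≤ ENNReal.ofReal (c i * (1 + r i)) := by
  refine ⟨fun i => max ((J i).toReal / c i - 1) 0, ?_, ?_⟩
  · rw [Metric.tendsto_nhds]
    intro ε hε
    filter_upwards [h (ε / 2) (by positivity), hc] with i hi hci
    have hJ : (J i).toReal / c i ≤ 1 + ε / 2 := by
      rw [div_le_iff₀' hci]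
      exact ENNReal.toReal_le_of_le_ofReal (by positivity) hi
    rw [Real.dist_eq, sub_zero, abs_of_nonneg (le_max_right _ _)]
    exact max_lt (by linarith) hε
  · filter_upwards [h 1 one_pos, hc] with i hi hci
    have hJ : J i ≠ ⊤ := ne_top_of_le_ne_top ENNReal.ofReal_ne_top hi
    refine (ENNReal.ofReal_toReal hJ).ge.trans (ENNReal.ofReal_le_ofReal ?_)
    rw [← div_le_iff₀' hci]
    linarith [le_max_left ((J i).toReal / c i - 1) 0]

namespace BanditQCD

variable {K : ℕ} {𝓧 : Type*} [MeasurableSpace 𝓧]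

section History

variable {A : ℕ → Path K 𝓧 → Fin K}

theorem history_mono (A : ℕ → Path K 𝓧 → Fin K) : Monotone (history A) := fun _ _ h =>
  biSup_mono fun _ hi => Finset.Icc_subset_Icc_right h hi

/-- The σ-algebra generated by the observations of all channels up to time `n`, whichever actions
are taken. It is independent of the observations made at time `n + 1`. -/
abbrev fullHistory (K : ℕ) (𝓧 : Type*) [MeasurableSpace 𝓧] (n : ℕ) : MeasurableSpace (Path K 𝓧) :=
  ⨆ i ∈ Set.Iic n, MeasurableSpace.comap (fun ω : Path K 𝓧 => ω i) inferInstance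

theorem fullHistory_mono : Monotone (fullHistory K 𝓧) := fun _ _ h =>
  biSup_mono fun _ hi => le_trans hi h

theorem fullHistory_le (n : ℕ) : fullHistory K 𝓧 n ≤ MeasurableSpace.pi :=
  iSup₂_le fun i _ => (measurable_pi_apply i).comap_le

theorem measurable_fullHistory_apply (n : ℕ) :
    Measurable[fullHistory K 𝓧 n] fun ω : Path K 𝓧 => ω n :=
  Measurable.of_comap_le <| le_iSup₂_of_le (f := fun i (_ : i ∈ Set.Iic n) =>
    MeasurableSpace.comap (fun ω : Path K 𝓧 => ω i) inferInstance) n Set.self_mem_Iic le_rfl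

theorem measurable_apply_action {m : MeasurableSpace (Path K 𝓧)} {i : ℕ}
    (hA : Measurable[m] (A i)) (hX : Measurable[m] fun ω : Path K 𝓧 => ω i) :
    Measurable[m] fun ω : Path K 𝓧 => ω i (A i ω) := by
  intro s hs
  have hunion : (fun ω : Path K 𝓧 => ω i (A i ω)) ⁻¹' s
      = ⋃ a, (A i ⁻¹' {a} ∩ (fun ω : Path K 𝓧 => ω i) ⁻¹' ((fun x => x a) ⁻¹' s)) := by
    ext ω; simp
  rw [hunion]
  exact MeasurableSet.iUnion fun a =>
    (hA (measurableSet_singleton a)).inter (hX (measurable_pi_apply a hs))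

theorem measurable_history_obs {i n : ℕ} (hi : 1 ≤ i) (hin : i ≤ n) :
    Measurable[history A n] fun ω : Path K 𝓧 => ω i (A i ω) :=
  Measurable.of_comap_le <| le_iSup₂_of_le (f := fun i (_ : i ∈ Finset.Icc 1 n) =>
    MeasurableSpace.comap (fun ω : Path K 𝓧 => ω i (A i ω)) inferInstance) i
    (Finset.mem_Icc.2 ⟨hi, hin⟩) le_rfl

theorem IsControlPolicy.history_le_fullHistory (hA : IsControlPolicy A) (n : ℕ) :
    history A n ≤ fullHistory K 𝓧 n := by
  induction n using Nat.strong_induction_on with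
  | _ n ih =>
    refine iSup₂_le fun i hi => Measurable.comap_le ?_
    obtain ⟨hi1, hin⟩ := Finset.mem_Icc.1 hi
    have hpast : history A (i - 1) ≤ fullHistory K 𝓧 n :=
      (ih (i - 1) (by omega)).trans (fullHistory_mono (by omega))
    exact measurable_apply_action ((hA i hi1).mono hpast le_rfl)
      ((measurable_fullHistory_apply i).mono (fullHistory_mono hin) le_rfl)

theorem IsControlPolicy.history_le (hA : IsControlPolicy A) (n : ℕ) :
    history A n ≤ MeasurableSpace.pi :=
  (hA.history_le_fullHistory n).trans (fullHistory_le n)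

theorem IsControlPolicy.measurableSet_action_eq (hA : IsControlPolicy A) {i n : ℕ} (hi : 1 ≤ i)
    (hin : i ≤ n + 1) (a : Fin K) : MeasurableSet[history A n] {ω | A i ω = a} :=
  (hA i hi).mono (history_mono A (by omega)) le_rfl (measurableSet_singleton a)

theorem one_le_windowStart (W n : ℕ) : 1 ≤ windowStart W n := Nat.le_add_left _ _

theorem IsControlPolicy.measurable_pulls (hA : IsControlPolicy A) (W : ℕ) (a : Fin K) (n : ℕ) :
    Measurable[history A (n - 1)] (pulls A W a n) := by
  have hsum : pulls A W a n
      = fun ω => ∑ i ∈ Finset.Ico (windowStart W n) n, if A i ω = a then 1 else 0 :=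
    funext fun ω => Finset.card_filter _ _
  rw [hsum]
  refine Finset.measurable_fun_sum _ fun i hi => ?_
  have hi := Finset.mem_Ico.1 hi
  exact Measurable.ite (hA.measurableSet_action_eq ((one_le_windowStart W n).trans hi.1)
    (by omega) a) measurable_const measurable_const

end History

section Law

variable (M : BanditQCD K 𝓧) {A : ℕ → Path K 𝓧 → Fin K} (ν : ℕ∞) (𝒜 : Finset (Fin K))

instance isProbabilityMeasure_law : IsProbabilityMeasure (M.law ν 𝒜) := by
  unfold law; infer_instance

theorem measurePreserving_obs (n : ℕ) (a : Fin K) :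
    MeasurePreserving (fun ω : Path K 𝓧 => ω n a) (M.law ν 𝒜) (M.obsLaw ν 𝒜 n a) :=
  (measurePreserving_eval (fun a => M.obsLaw ν 𝒜 n a) a).comp
    (measurePreserving_eval_infinitePi
      (fun n : ℕ => Measure.pi fun a : Fin K => M.obsLaw ν 𝒜 n a) n)

theorem indep_fullHistory_obs {n : ℕ} (hn : 1 ≤ n) :
    Indep (fullHistory K 𝓧 (n - 1)) (MeasurableSpace.comap (fun ω : Path K 𝓧 => ω n) inferInstance)
      (M.law ν 𝒜) := by
  have h : iIndep (fun i => MeasurableSpace.comap (fun ω : Path K 𝓧 => ω i) inferInstance)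
      (M.law ν 𝒜) :=
    iIndepFun_infinitePi (P := fun n : ℕ => Measure.pi fun a : Fin K => M.obsLaw ν 𝒜 n a)
      (X := fun _ x => x) (fun _ => measurable_id)
  have hdisj := indep_iSup_of_disjoint (fun i => (measurable_pi_apply i).comap_le) h
    (S := Set.Iic (n - 1)) (T := {n}) (by simp; omega)
  rwa [iSup_singleton] at hdisj

variable {ν 𝒜}

theorem indep_history_obs (hA : IsControlPolicy A) {n : ℕ} (hn : 1 ≤ n) (a : Fin K) :
    Indep (history A (n - 1)) (MeasurableSpace.comap (fun ω : Path K 𝓧 => ω n a) inferInstance)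
      (M.law ν 𝒜) :=
  indep_of_indep_of_le_right
    (indep_of_indep_of_le_left (M.indep_fullHistory_obs ν 𝒜 hn) (hA.history_le_fullHistory _))
    ((measurable_pi_apply a).comp (comap_measurable fun ω : Path K 𝓧 => ω n)).comap_le

theorem lintegral_mul_obs (hA : IsControlPolicy A) {n : ℕ} (hn : 1 ≤ n) (a : Fin K)
    {F : Path K 𝓧 → ℝ≥0∞} (hF : Measurable[history A (n - 1)] F) {g : 𝓧 → ℝ≥0∞}
    (hg : Measurable g) :
    ∫⁻ ω, F ω * g (ω n a) ∂(M.law ν 𝒜)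
      = (∫⁻ ω, F ω ∂(M.law ν 𝒜)) * ∫⁻ x, g x ∂(M.obsLaw ν 𝒜 n a) := by
  have hX := M.measurePreserving_obs ν 𝒜 n a
  rw [← hX.lintegral_comp hg]
  exact lintegral_mul_eq_lintegral_mul_lintegral_of_independent_measurableSpace
    (hA.history_le (n - 1)) hX.measurable.comap_le (M.indep_history_obs hA hn a) hF
    (hg.comp (comap_measurable fun ω : Path K 𝓧 => ω n a))

theorem setIntegral_obs (hA : IsControlPolicy A) {n : ℕ} (hn : 1 ≤ n) (a : Fin K)
    {E : Set (Path K 𝓧)} (hE : MeasurableSet[history A (n - 1)] E) {φ : 𝓧 → ℝ}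
    (hφ : Measurable φ) :
    ∫ ω in E, φ (ω n a) ∂(M.law ν 𝒜)
      = (M.law ν 𝒜).real E * ∫ x, φ x ∂(M.obsLaw ν 𝒜 n a) := by
  have hE' := hA.history_le (n - 1) E hE
  have hX := M.measurePreserving_obs ν 𝒜 n a
  have hind : IndepFun (E.indicator fun _ => (1 : ℝ)) (fun ω : Path K 𝓧 => φ (ω n a))
      (M.law ν 𝒜) :=
    indep_of_indep_of_le_left (indep_of_indep_of_le_right (M.indep_history_obs hA hn a)
      (hφ.comp (comap_measurable _)).comap_le) (measurable_const.indicator hE).comap_le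
  calc ∫ ω in E, φ (ω n a) ∂(M.law ν 𝒜)
      = ∫ ω, E.indicator (fun _ => (1 : ℝ)) ω * φ (ω n a) ∂(M.law ν 𝒜) := by
        rw [← integral_indicator hE']
        exact integral_congr_ae (ae_of_all _ fun ω => by
          by_cases hω : ω ∈ E <;> simp only [hω, Set.indicator_of_mem, Set.indicator_of_notMem,
            not_false_eq_true, one_mul, zero_mul])
    _ = _ := by
        rw [hind.integral_fun_mul_eq_mul_integral
          (measurable_const.indicator hE').aestronglyMeasurable
          (hφ.comp hX.measurable).aestronglyMeasurable, integral_indicator_const _ hE', ← hX.map_eq,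
          integral_map hX.aemeasurable hφ.aestronglyMeasurable, smul_eq_mul, mul_one]

end Law

section SelectedFactor

variable {A : ℕ → Path K 𝓧 → Fin K} {g : 𝓧 → ℝ≥0∞}

/-- The factor that time `n` contributes to a product of `g (X_{a,i})` over the times `i` at which
action `a` is selected. -/
def selectedFactor (A : ℕ → Path K 𝓧 → Fin K) (g : 𝓧 → ℝ≥0∞) (a : Fin K) (n : ℕ)
    (ω : Path K 𝓧) : ℝ≥0∞ :=
  if A n ω = a then g (ω n a) else 1

theorem measurable_selectedFactor (hA : IsControlPolicy A) (hg : Measurable g) (a : Fin K) {n : ℕ}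
    (hn : 1 ≤ n) : Measurable[history A n] (selectedFactor A g a n) := by
  have h : selectedFactor A g a n = fun ω => if A n ω = a then g (ω n (A n ω)) else 1 := by
    ext ω; rw [selectedFactor]; split_ifs with h <;> simp only [h]
  rw [h]
  exact Measurable.ite (hA.measurableSet_action_eq hn n.le_succ a)
    (hg.comp (measurable_history_obs hn le_rfl)) measurable_const

theorem setLIntegral_mul_selectedFactor_le (M : BanditQCD K 𝓧) {ν : ℕ∞} {𝒜 : Finset (Fin K)}
    (hA : IsControlPolicy A) (hg : Measurable g) {a : Fin K} {n : ℕ} (hn : 1 ≤ n)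
    (hmom : ∫⁻ x, g x ∂(M.obsLaw ν 𝒜 n a) ≤ 1) {E : Set (Path K 𝓧)}
    (hE : MeasurableSet[history A (n - 1)] E) {F : Path K 𝓧 → ℝ≥0∞}
    (hF : Measurable[history A (n - 1)] F) :
    ∫⁻ ω in E, F ω * selectedFactor A g a n ω ∂(M.law ν 𝒜) ≤ ∫⁻ ω in E, F ω ∂(M.law ν 𝒜) := by
  set S : Set (Path K 𝓧) := {ω | A n ω = a}
  have hS : MeasurableSet[history A (n - 1)] S := hA.measurableSet_action_eq hn (by omega) a
  have hE' := hA.history_le _ E hE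
  have hS' := hA.history_le _ S hS
  rw [← lintegral_inter_add_sdiff _ E hS', ← lintegral_inter_add_sdiff _ E hS']
  gcongr ?_ + ?_
  · calc ∫⁻ ω in E ∩ S, F ω * selectedFactor A g a n ω ∂(M.law ν 𝒜)
        = ∫⁻ ω, (E ∩ S).indicator F ω * g (ω n a) ∂(M.law ν 𝒜) := by
          rw [← lintegral_indicator (hE'.inter hS')]
          refine lintegral_congr fun ω => ?_
          by_cases hω : ω ∈ E ∩ S
          · simp only [Set.indicator_of_mem hω, selectedFactor, if_pos (show A n ω = a from hω.2)]
          · simp only [Set.indicator_of_notMem hω, zero_mul]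
      _ = (∫⁻ ω in E ∩ S, F ω ∂(M.law ν 𝒜)) * ∫⁻ x, g x ∂(M.obsLaw ν 𝒜 n a) := by
          rw [M.lintegral_mul_obs hA hn a (hF.indicator (hE.inter hS)) hg,
            lintegral_indicator (hE'.inter hS')]
      _ ≤ _ := mul_le_of_le_one_right' hmom
  · refine (setLIntegral_congr_fun (hE'.diff hS') fun ω hω => ?_).le
    simp only [selectedFactor, if_neg (show ¬A n ω = a from hω.2), mul_one]

end SelectedFactor

section Alarm

variable (M : BanditQCD K 𝓧) {A : ℕ → Path K 𝓧 → Fin K} {b : ℝ} {n : ℕ} {ω : Path K 𝓧}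

/-- The likelihood ratio `f₁ a x / f₀ a x`, the exponential of `LLR`. -/
noncomputable def likelihoodRatio (a : Fin K) (x : 𝓧) : ℝ≥0∞ := M.f₁ a x / M.f₀ a x

theorem measurable_likelihoodRatio (a : Fin K) : Measurable (M.likelihoodRatio a) :=
  (M.measurable_f₁ a).div (M.measurable_f₀ a)

theorem measurable_LLR (a : Fin K) : Measurable (M.LLR a) :=
  (M.measurable_likelihoodRatio a).ennreal_log

theorem exp_LLR (a : Fin K) (x : 𝓧) : (M.LLR a x).exp = M.likelihoodRatio a x :=
  ENNReal.exp_log _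

theorem measurable_cusum (hA : IsControlPolicy A) (a : Fin K) (n : ℕ) :
    Measurable[history A n] (M.cusum A a n) := by
  induction n with
  | zero => exact measurable_const
  | succ n ih =>
    have ih := ih.mono (history_mono A n.le_succ) le_rfl
    have hsucc : M.cusum A a (n + 1) = fun ω => if A (n + 1) ω = a then
        max (M.cusum A a n ω) 0 + M.LLR a (ω (n + 1) (A (n + 1) ω)) else M.cusum A a n ω := by
      ext ω; rw [cusum]; split_ifs with h <;> simp only [h]
    rw [hsucc]
    exact Measurable.ite (hA.measurableSet_action_eq (by omega) (by omega) a)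
      ((ih.max measurable_const).add
        ((M.measurable_LLR a).comp (measurable_history_obs (by omega) le_rfl))) ih

theorem lt_alarm_iff :
    (n : ℕ∞) < M.alarm A b ω ↔ ∀ m, 1 ≤ m → m ≤ n → ∀ a, M.cusum A a m ω < b := by
  constructor
  · intro h m hm hmn a
    by_contra! hc
    have hle : M.alarm A b ω ≤ m := sInf_le ⟨m, hm, ⟨a, hc⟩, rfl⟩
    exact absurd (h.trans_le hle) (not_lt.2 (by exact_mod_cast hmn))
  · intro h
    refine (show (n : ℕ∞) < (n + 1 : ℕ) by exact_mod_cast n.lt_succ_self).trans_le (le_sInf ?_)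
    rintro t ⟨m, hm, ⟨a, ha⟩, rfl⟩
    by_contra! hc
    exact absurd ha (not_le.2 (h m hm (Nat.lt_succ_iff.1 (by exact_mod_cast hc)) a))

theorem alarm_pos (A : ℕ → Path K 𝓧 → Fin K) (b : ℝ) (ω : Path K 𝓧) : 0 < M.alarm A b ω :=
  M.lt_alarm_iff (n := 0).2 fun _ h h' => absurd (h.trans h') (by norm_num)

theorem exists_le_cusum_of_alarm_eq (h : M.alarm A b ω = n) : ∃ a, b ≤ M.cusum A a n ω := by
  have hne : {t : ℕ∞ | ∃ n : ℕ, 1 ≤ n ∧ (∃ a, (b : EReal) ≤ M.cusum A a n ω) ∧ t = n}.Nonempty := by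
    by_contra! hempty
    rw [alarm, hempty, sInf_empty] at h
    exact ENat.natCast_ne_top n h.symm
  obtain ⟨m, -, ha, hm⟩ := csInf_mem hne
  rwa [← show m = n by exact_mod_cast hm.symm.trans h]

theorem measurableSet_lt_alarm (hA : IsControlPolicy A) (b : ℝ) (n : ℕ) :
    MeasurableSet[history A n] {ω | (n : ℕ∞) < M.alarm A b ω} := by
  have hinter : {ω | (n : ℕ∞) < M.alarm A b ω}
      = ⋂ m ∈ Finset.Icc 1 n, ⋂ a, {ω | M.cusum A a m ω < b} := by
    ext ω
    simp only [Set.mem_ofPred_eq, lt_alarm_iff, Set.mem_iInter, Finset.mem_Icc, and_imp]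
  rw [hinter]
  exact Finset.measurableSet_biInter _ fun m hm => MeasurableSet.iInter fun a =>
    ((M.measurable_cusum hA a m).mono (history_mono A (Finset.mem_Icc.1 hm).2) le_rfl)
      measurableSet_Iio

end Alarm

section FalseAlarm

variable (M : BanditQCD K 𝓧) {A : ℕ → Path K 𝓧 → Fin K}

/-- The Shiryaev-Roberts statistic of action `a` under the policy `A`. The exponential
of the CuSum statistic is at most its maximum with `1`; without a change, its drift is at most the
probability of selecting `a`. -/
noncomputable def shiryaevRoberts (A : ℕ → Path K 𝓧 → Fin K) (a : Fin K) : ℕ → Path K 𝓧 → ℝ≥0∞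
  | 0, _ => 0
  | n + 1, ω => ((if A (n + 1) ω = a then 1 else 0) + shiryaevRoberts A a n ω)
      * selectedFactor A (M.likelihoodRatio a) a (n + 1) ω

theorem measurable_shiryaevRoberts (hA : IsControlPolicy A) (a : Fin K) (n : ℕ) :
    Measurable[history A n] (M.shiryaevRoberts A a n) := by
  induction n with
  | zero => exact measurable_const
  | succ n ih =>
    exact ((Measurable.ite (hA.measurableSet_action_eq (by omega) (by omega) a) measurable_const
      measurable_const).add (ih.mono (history_mono A n.le_succ) le_rfl)).mul
      (measurable_selectedFactor hA (M.measurable_likelihoodRatio a) a (by omega))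

theorem exp_cusum_le_max_shiryaevRoberts (a : Fin K) (n : ℕ) (ω : Path K 𝓧) :
    (M.cusum A a n ω).exp ≤ max (M.shiryaevRoberts A a n ω) 1 := by
  induction n with
  | zero => simp [cusum]
  | succ n ih =>
    rw [cusum, shiryaevRoberts, selectedFactor]
    split_ifs with h
    · rw [EReal.exp_add, exp_LLR, EReal.exp_monotone.map_max, EReal.exp_zero]
      refine le_max_of_le_left (mul_le_mul_left ?_ _)
      exact (max_le_max_right 1 ih).trans (max_le (max_le le_add_self le_self_add) le_self_add)
    · rwa [zero_add, mul_one]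

theorem lintegral_likelihoodRatio_pre_le (a : Fin K) :
    ∫⁻ x, M.likelihoodRatio a x ∂(M.pre a) ≤ 1 := by
  rw [pre, lintegral_withDensity_eq_lintegral_mul _ (M.measurable_f₀ a)
    (M.measurable_likelihoodRatio a), ← M.lintegral_f₁ a]
  exact lintegral_mono fun x => ENNReal.mul_div_le

theorem setLIntegral_shiryaevRoberts_succ_le (hA : IsControlPolicy A) (a : Fin K) (n : ℕ)
    {E : Set (Path K 𝓧)} (hE : MeasurableSet[history A n] E) :
    ∫⁻ ω in E, M.shiryaevRoberts A a (n + 1) ω ∂M.lawNoChange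
      ≤ M.lawNoChange.restrict E {ω | A (n + 1) ω = a}
        + ∫⁻ ω in E, M.shiryaevRoberts A a n ω ∂M.lawNoChange := by
  have hS : MeasurableSet[history A n] {ω | A (n + 1) ω = a} :=
    hA.measurableSet_action_eq (by omega) le_rfl a
  have hsel : Measurable[history A n] ({ω | A (n + 1) ω = a}.indicator (1 : Path K 𝓧 → ℝ≥0∞)) :=
    Measurable.indicator measurable_const hS
  rw [← lintegral_indicator_one (hA.history_le n _ hS),
    ← lintegral_add_left (hsel.mono (hA.history_le n) le_rfl)]
  refine le_of_eq_of_le (lintegral_congr fun ω => ?_)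
    (M.setLIntegral_mul_selectedFactor_le (ν := ⊤) (𝒜 := ∅) hA (M.measurable_likelihoodRatio a)
      (a := a) (n := n + 1) (by omega) ?_ hE (hsel.add (M.measurable_shiryaevRoberts hA a n)))
  · simp only [shiryaevRoberts, Set.indicator_apply, Set.mem_ofPred_eq, Pi.one_apply]
  · simpa [obsLaw] using M.lintegral_likelihoodRatio_pre_le a

theorem setLIntegral_sum_shiryaevRoberts_succ_le (hA : IsControlPolicy A) (n : ℕ)
    {E : Set (Path K 𝓧)} (hE : MeasurableSet[history A n] E) :
    ∫⁻ ω in E, ∑ a, M.shiryaevRoberts A a (n + 1) ω ∂M.lawNoChange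
      ≤ M.lawNoChange E + ∫⁻ ω in E, ∑ a, M.shiryaevRoberts A a n ω ∂M.lawNoChange := by
  have hR (n : ℕ) (a : Fin K) : Measurable (M.shiryaevRoberts A a n) :=
    (M.measurable_shiryaevRoberts hA a n).mono (hA.history_le n) le_rfl
  have hpart : ∑ a, M.lawNoChange.restrict E {ω | A (n + 1) ω = a} = M.lawNoChange E := by
    refine (sum_measure_preimage_singleton _ fun a _ =>
      hA.history_le n _ (hA.measurableSet_action_eq (by omega) le_rfl a)).trans ?_
    rw [Finset.coe_univ, Set.preimage_univ, Measure.restrict_apply_univ]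
  rw [← hpart, lintegral_finsetSum _ fun a _ => hR (n + 1) a,
    lintegral_finsetSum _ fun a _ => hR n a, ← Finset.sum_add_distrib]
  exact Finset.sum_le_sum fun a _ => M.setLIntegral_shiryaevRoberts_succ_le hA a n hE

theorem exp_le_meanTimeToFalseAlarm (hA : IsControlPolicy A) (b : ℝ) :
    ENNReal.ofReal (Real.exp b) ≤ M.meanTimeToFalseAlarm (M.alarm A b) := by
  have : IsProbabilityMeasure M.lawNoChange := M.isProbabilityMeasure_law ⊤ ∅
  have hT (n : ℕ) := M.measurableSet_lt_alarm hA b n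
  rcases le_or_gt b 0 with hb | hb
  · calc ENNReal.ofReal (Real.exp b) ≤ ∫⁻ _, 1 ∂M.lawNoChange := by
          simpa using hb
      _ ≤ _ := lintegral_mono fun ω => by
          rw [← ENat.toENNReal_one, ENat.toENNReal_le]
          exact Order.one_le_iff_pos.2 (M.alarm_pos A b ω)
  · refine le_lintegral_of_forall_stopped_ge (fun n => hA.history_le n _ (hT n))
      (S := fun n ω => ∑ a, M.shiryaevRoberts A a n ω) (funext fun ω => by simp [shiryaevRoberts])
      (fun n => M.setLIntegral_sum_shiryaevRoberts_succ_le hA n (hT n)) fun n ω hn => ?_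
    obtain ⟨a, ha⟩ := M.exists_le_cusum_of_alarm_eq hn
    have hmax : ENNReal.ofReal (Real.exp b) ≤ max (M.shiryaevRoberts A a n ω) 1 := by
      simpa using (EReal.exp_monotone ha).trans (M.exp_cusum_le_max_shiryaevRoberts a n ω)
    have ha : ENNReal.ofReal (Real.exp b) ≤ M.shiryaevRoberts A a n ω :=
      (le_max_iff.1 hmax).resolve_right (by simpa using hb)
    exact ha.trans (Finset.single_le_sum_of_canonicallyOrdered
      (f := fun a => M.shiryaevRoberts A a n ω) (Finset.mem_univ a))

end FalseAlarm

section SubgaussianLLR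

variable (M : BanditQCD K 𝓧) {v : ℝ≥0} {a : Fin K}

/-- The standing assumption on a single action `a`, without the positivity of its divergence. -/
structure SubgaussianLLR (v : ℝ≥0) (a : Fin K) : Prop where
  ac : M.post a ≪ M.pre a
  subGaussian : HasSubgaussianMGF (fun x => (M.LLR a x).toReal - M.KL a) v (M.post a)

theorem measurable_toReal_LLR (a : Fin K) : Measurable fun x => (M.LLR a x).toReal :=
  (M.measurable_LLR a).ereal_toReal

variable {M}

theorem ae_likelihoodRatio_ne_zero_and_ne_top (hac : M.post a ≪ M.pre a) :
    ∀ᵐ x ∂(M.post a), M.likelihoodRatio a x ≠ 0 ∧ M.likelihoodRatio a x ≠ ⊤ := by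
  have h₁ : ∀ᵐ x ∂(M.post a), M.f₁ a x ≠ 0 ∧ M.f₁ a x ≠ ⊤ :=
    ae_withDensity_ne_zero_and_ne_top (M.measurable_f₁ a) (by simp [M.lintegral_f₁ a])
  have h₀ : ∀ᵐ x ∂(M.pre a), M.f₀ a x ≠ 0 ∧ M.f₀ a x ≠ ⊤ :=
    ae_withDensity_ne_zero_and_ne_top (M.measurable_f₀ a) (by simp [M.lintegral_f₀ a])
  filter_upwards [h₁, hac.ae_le h₀] with x hx₁ hx₀
  exact ⟨ENNReal.div_ne_zero.2 ⟨hx₁.1, hx₀.2⟩, ENNReal.div_ne_top hx₁.2 hx₀.1⟩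

theorem ae_coe_toReal_LLR (hac : M.post a ≪ M.pre a) :
    ∀ᵐ x ∂(M.post a), ((M.LLR a x).toReal : EReal) = M.LLR a x := by
  filter_upwards [ae_likelihoodRatio_ne_zero_and_ne_top hac] with x hx
  exact EReal.coe_toReal (mt ENNReal.log_eq_top_iff.1 hx.2) (mt ENNReal.log_eq_bot_iff.1 hx.1)

theorem SubgaussianLLR.integrable_LLR (h : M.SubgaussianLLR v a) :
    Integrable (fun x => (M.LLR a x).toReal) (M.post a) := by
  simpa only [Pi.add_def, sub_add_cancel] using
    h.subGaussian.integrable.add (integrable_const (M.KL a))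

theorem SubgaussianLLR.lintegral_likelihoodRatio_rpow_le (h : M.SubgaussianLLR v a) (t : ℝ) :
    ∫⁻ x, M.likelihoodRatio a x ^ t ∂(M.post a)
      ≤ ENNReal.ofReal (Real.exp (t * (M.KL a + v * t / 2))) := by
  have hcenter : ∀ᵐ x ∂(M.post a), M.likelihoodRatio a x ^ t = ENNReal.ofReal
      (Real.exp (t * M.KL a) * Real.exp (t * ((M.LLR a x).toReal - M.KL a))) := by
    filter_upwards [ae_coe_toReal_LLR h.ac] with x hx
    rw [← exp_LLR, ← hx, EReal.exp_coe, ENNReal.ofReal_rpow_of_pos (Real.exp_pos _),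
      ← Real.exp_mul, ← Real.exp_add, EReal.toReal_coe]
    ring_nf
  rw [lintegral_congr_ae hcenter, ← ofReal_integral_eq_lintegral_ofReal
    ((h.subGaussian.integrable_exp_mul t).const_mul _) (ae_of_all _ fun x => by positivity),
    integral_const_mul]
  refine ENNReal.ofReal_le_ofReal ?_
  calc Real.exp (t * M.KL a) * ∫ x, Real.exp (t * ((M.LLR a x).toReal - M.KL a)) ∂(M.post a)
      ≤ Real.exp (t * M.KL a) * Real.exp (v * t ^ 2 / 2) := by
        gcongr; exact h.subGaussian.mgf_le t
    _ = _ := by rw [← Real.exp_add]; ring_nf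

end SubgaussianLLR

section Chernoff

variable {M : BanditQCD K 𝓧} {A : ℕ → Path K 𝓧 → Fin K} {𝒜 : Finset (Fin K)} {a : Fin K}

theorem obsLaw_of_mem {ν n : ℕ} (h : ν ≤ n) (ha : a ∈ 𝒜) : M.obsLaw ν 𝒜 n a = M.post a := by
  simp [obsLaw, h, ha]

theorem obsLaw_of_notMem {ν : ℕ∞} {n : ℕ} (ha : a ∉ 𝒜) : M.obsLaw ν 𝒜 n a = M.pre a := by
  simp [obsLaw, ha]

theorem ae_forall_obs_of_ae_post {p : 𝓧 → Prop} (hp : ∀ᵐ x ∂(M.post a), p x) (ν : ℕ)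
    (ha : a ∈ 𝒜) : ∀ᵐ ω ∂(M.law ν 𝒜), ∀ i, ν ≤ i → p (ω i a) := by
  refine ae_all_iff.2 fun i => ?_
  by_cases hi : ν ≤ i
  · rw [← obsLaw_of_mem hi ha] at hp
    exact ((M.measurePreserving_obs ν 𝒜 i a).quasiMeasurePreserving.ae hp).mono fun _ h _ => h
  · exact ae_of_all _ fun _ h => absurd h hi

theorem setLIntegral_prod_selectedFactor_le {ν : ℕ∞} (hA : IsControlPolicy A) {s n : ℕ}
    (hs : 1 ≤ s) (hn : s ≤ n) {g : 𝓧 → ℝ≥0∞} (hg : Measurable g)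
    (hmom : ∀ i, s ≤ i → ∫⁻ x, g x ∂(M.obsLaw ν 𝒜 i a) ≤ 1) {E : Set (Path K 𝓧)}
    (hE : MeasurableSet[history A (s - 1)] E) :
    ∫⁻ ω in E, ∏ i ∈ Finset.Ico s n, selectedFactor A g a i ω ∂(M.law ν 𝒜) ≤ M.law ν 𝒜 E := by
  induction n, hn using Nat.le_induction with
  | base => simp
  | succ n hn ih =>
    simp_rw [Finset.prod_Ico_succ_top hn]
    refine (M.setLIntegral_mul_selectedFactor_le hA hg (hs.trans hn) (hmom n hn)
      (history_mono A (by omega) _ hE) ?_).trans ih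
    exact Finset.measurable_fun_prod _ fun i hi =>
      have hi := Finset.mem_Ico.1 hi
      (measurable_selectedFactor hA hg a (hs.trans hi.1)).mono (history_mono A (by omega)) le_rfl

theorem windowStart_le {W n : ℕ} (hn : 1 ≤ n) : windowStart W n ≤ n := by
  have := Nat.div_mul_le_self (n - 1) W
  unfold windowStart; omega

theorem prod_selectedFactor_const_mul {𝓧 : Type*} (A : ℕ → Path K 𝓧 → Fin K) (a : Fin K)
    (c : ℝ≥0∞) (g : 𝓧 → ℝ≥0∞) (W n : ℕ) (ω : Path K 𝓧) :
    ∏ i ∈ Finset.Ico (windowStart W n) n, selectedFactor A (fun x => c * g x) a i ω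
      = c ^ pulls A W a n ω
        * ∏ i ∈ (Finset.Ico (windowStart W n) n).filter (fun i => A i ω = a), g (ω i a) := by
  rw [pulls, ← Finset.prod_const, ← Finset.prod_mul_distrib, Finset.prod_filter]
  rfl

theorem measure_inter_le_of_exp_le_prod {ν : ℕ∞} (hA : IsControlPolicy A) {W n : ℕ} (hn : 1 ≤ n)
    {g : 𝓧 → ℝ≥0∞} (hg : Measurable g) {c : ℝ}
    (hmom : ∀ i, windowStart W n ≤ i →
      ∫⁻ x, g x ∂(M.obsLaw ν 𝒜 i a) ≤ ENNReal.ofReal (Real.exp c))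
    {E F : Set (Path K 𝓧)} (hE : MeasurableSet[history A (windowStart W n - 1)] E) {k : ℕ} {x : ℝ}
    (hF : ∀ᵐ ω ∂(M.law ν 𝒜), ω ∈ F → pulls A W a n ω = k ∧ ENNReal.ofReal (Real.exp x)
      ≤ ∏ i ∈ (Finset.Ico (windowStart W n) n).filter (fun i => A i ω = a), g (ω i a)) :
    M.law ν 𝒜 (E ∩ F) ≤ ENNReal.ofReal (Real.exp (k * c - x)) * M.law ν 𝒜 E := by
  set g' : 𝓧 → ℝ≥0∞ := fun x => ENNReal.ofReal (Real.exp (-c)) * g x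
  have hg' : Measurable g' := hg.const_mul _
  have hmom' (i : ℕ) (hi : windowStart W n ≤ i) : ∫⁻ x, g' x ∂(M.obsLaw ν 𝒜 i a) ≤ 1 := by
    rw [lintegral_const_mul _ hg]
    refine (mul_le_mul_right (hmom i hi) _).trans_eq ?_
    rw [ofReal_exp_mul_ofReal_exp, neg_add_cancel, Real.exp_zero, ENNReal.ofReal_one]
  set Λ : Path K 𝓧 → ℝ≥0∞ := fun ω =>
    ∏ i ∈ Finset.Ico (windowStart W n) n, selectedFactor A g' a i ω
  have hΛ : Measurable Λ := Finset.measurable_fun_prod _ fun i hi =>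
    (measurable_selectedFactor hA hg' a
      ((one_le_windowStart W n).trans (Finset.mem_Ico.1 hi).1)).mono (hA.history_le i) le_rfl
  have hle : ∀ᵐ ω ∂(M.law ν 𝒜), ω ∈ F → ENNReal.ofReal (Real.exp (x - k * c)) ≤ Λ ω := by
    filter_upwards [hF] with ω hω hωF
    obtain ⟨hk, hx⟩ := hω hωF
    calc ENNReal.ofReal (Real.exp (x - k * c))
        = ENNReal.ofReal (Real.exp (-c)) ^ k * ENNReal.ofReal (Real.exp x) := by
          rw [← ENNReal.ofReal_pow (Real.exp_pos _).le, ← Real.exp_nat_mul,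
            ofReal_exp_mul_ofReal_exp]
          ring_nf
      _ ≤ Λ ω := by
          rw [show Λ ω = _ from prod_selectedFactor_const_mul A a _ g W n ω, hk]
          gcongr
  have hE' := hA.history_le _ E hE
  refine neg_sub x (k * c) ▸ le_ofReal_exp_neg_mul ?_
  calc ENNReal.ofReal (Real.exp (x - k * c)) * M.law ν 𝒜 (E ∩ F)
      ≤ ENNReal.ofReal (Real.exp (x - k * c))
        * (M.law ν 𝒜).restrict E {ω | ENNReal.ofReal (Real.exp (x - k * c)) ≤ Λ ω} := by
        rw [Measure.restrict_apply' hE', Set.inter_comm]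
        exact mul_le_mul_right (measure_mono_ae (hle.mono fun ω hω h => ⟨hω h.1, h.2⟩)) _
    _ ≤ ∫⁻ ω in E, Λ ω ∂(M.law ν 𝒜) := mul_meas_ge_le_lintegral₀ hΛ.aemeasurable _
    _ ≤ M.law ν 𝒜 E := setLIntegral_prod_selectedFactor_le hA (one_le_windowStart W n)
        (windowStart_le hn) hg' hmom' hE

theorem exp_sum_LLR (s : Finset ℕ) (ω : Path K 𝓧) :
    (∑ i ∈ s, M.LLR a (ω i a)).exp = ∏ i ∈ s, M.likelihoodRatio a (ω i a) := by
  simp_rw [ereal_exp_sum, exp_LLR]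

theorem measure_inter_le_meanReward_le {ν : ℕ∞} (hA : IsControlPolicy A) {W n : ℕ} (hn : 1 ≤ n)
    {t q : ℝ} (ht : 0 ≤ t)
    (hmom : ∀ i, windowStart W n ≤ i → ∫⁻ x, M.likelihoodRatio a x ^ t ∂(M.obsLaw ν 𝒜 i a)
      ≤ ENNReal.ofReal (Real.exp (t * q)))
    {E : Set (Path K 𝓧)} (hE : MeasurableSet[history A (windowStart W n - 1)] E) {k : ℕ}
    (hk : 1 ≤ k) (y : ℝ) :
    M.law ν 𝒜 (E ∩ {ω | pulls A W a n ω = k ∧ (y : EReal) ≤ M.meanReward A W a n ω})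
      ≤ ENNReal.ofReal (Real.exp (-(t * k * (y - q)))) * M.law ν 𝒜 E := by
  rw [show -(t * k * (y - q)) = k * (t * q) - y * k * t by ring]
  refine measure_inter_le_of_exp_le_prod hA hn ((M.measurable_likelihoodRatio a).pow_const t) hmom
    hE (ae_of_all _ ?_)
  rintro ω ⟨hpulls, hy⟩
  refine ⟨hpulls, ?_⟩
  rw [meanReward, hpulls, EReal.le_div_iff_mul_le (by exact_mod_cast hk) (EReal.coe_ne_top _),
    ← EReal.coe_mul, ← EReal.exp_le_exp_iff, EReal.exp_coe, exp_sum_LLR] at hy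
  rw [ENNReal.prod_rpow_of_nonneg ht, Real.exp_mul, ← ENNReal.ofReal_rpow_of_pos (Real.exp_pos _)]
  exact ENNReal.rpow_le_rpow hy ht

theorem measure_inter_meanReward_le_le {v : ℝ≥0} (h : M.SubgaussianLLR v a)
    (hA : IsControlPolicy A) {ν W n : ℕ} (hn : 1 ≤ n) (hν : ν ≤ windowStart W n) (ha : a ∈ 𝒜)
    {t : ℝ} (ht : 0 ≤ t) {E : Set (Path K 𝓧)}
    (hE : MeasurableSet[history A (windowStart W n - 1)] E) {k : ℕ} (hk : 1 ≤ k) (y : ℝ) :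
    M.law ν 𝒜 (E ∩ {ω | pulls A W a n ω = k ∧ M.meanReward A W a n ω ≤ y})
      ≤ ENNReal.ofReal (Real.exp (-(t * k * (M.KL a - v * t / 2 - y)))) * M.law ν 𝒜 E := by
  have hlaw (i : ℕ) (hi : windowStart W n ≤ i) : M.obsLaw ν 𝒜 i a = M.post a :=
    obsLaw_of_mem (hν.trans hi) ha
  have hfinite : ∀ᵐ ω ∂(M.law ν 𝒜), ∀ i, ν ≤ i → M.likelihoodRatio a (ω i a) ≠ ⊤ :=
    ae_forall_obs_of_ae_post ((ae_likelihoodRatio_ne_zero_and_ne_top h.ac).mono fun _ h => h.2)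
      ν ha
  rw [show -(t * k * (M.KL a - v * t / 2 - y))
    = k * (-t * (M.KL a + v * -t / 2)) - y * k * -t by ring]
  refine measure_inter_le_of_exp_le_prod hA hn ((M.measurable_likelihoodRatio a).pow_const (-t))
    (fun i hi => (hlaw i hi).symm ▸ h.lintegral_likelihoodRatio_rpow_le (-t)) hE ?_
  filter_upwards [hfinite] with ω hω
  rintro ⟨hpulls, hy⟩
  refine ⟨hpulls, ?_⟩
  rw [meanReward, hpulls, EReal.div_le_iff_le_mul (by exact_mod_cast hk) (EReal.coe_ne_top _),
    ← EReal.coe_mul, ← EReal.exp_le_exp_iff, EReal.exp_coe, exp_sum_LLR, mul_comm] at hy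
  rw [ENNReal.prod_rpow_of_ne_top fun i hi =>
      hω i (hν.trans (Finset.mem_Ico.1 (Finset.mem_filter.1 hi).1).1),
    Real.exp_mul, ← ENNReal.ofReal_rpow_of_pos (Real.exp_pos _), ENNReal.rpow_neg,
    ENNReal.rpow_neg, ENNReal.inv_le_inv]
  exact ENNReal.rpow_le_rpow hy ht

end Chernoff

section Window

/-- The `j`-th interval of length `W`, where `j` is counted from `0` and times from `1`. -/
def window (W j : ℕ) : Finset ℕ := Finset.Ico (j * W + 1) (j * W + 1 + W)

variable {W j n : ℕ}

theorem mem_window : n ∈ window W j ↔ j * W + 1 ≤ n ∧ n < j * W + 1 + W := Finset.mem_Ico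

theorem card_window (W j : ℕ) : (window W j).card = W := by
  rw [window, Nat.card_Ico, Nat.add_sub_cancel_left]

theorem one_le_of_mem_window (hn : n ∈ window W j) : 1 ≤ n :=
  (Nat.le_add_left 1 _).trans (mem_window.1 hn).1

theorem windowStart_of_mem_window (hn : n ∈ window W j) : windowStart W n = j * W + 1 := by
  obtain ⟨h₁, h₂⟩ := mem_window.1 hn
  have hdiv : (n - 1) / W = j := Nat.div_eq_of_lt_le (by omega) (by rw [Nat.add_mul]; omega)
  rw [windowStart, hdiv]

theorem pulls_le_of_mem_window {K : ℕ} {𝓧 : Type*} {A : ℕ → Path K 𝓧 → Fin K}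
    (hn : n ∈ window W j) (a : Fin K) (ω : Path K 𝓧) : pulls A W a n ω ≤ W := by
  refine (Finset.card_filter_le _ _).trans ?_
  rw [windowStart_of_mem_window hn, Nat.card_Ico]
  have := (mem_window.1 hn).2
  omega

end Window

section UCB

variable {M : BanditQCD K 𝓧} {v : ℝ≥0} {A : ℕ → Path K 𝓧 → Fin K} {W j n : ℕ}
  {𝒜 : Finset (Fin K)} {a a' : Fin K} {E : Set (Path K 𝓧)}

theorem measure_inter_ucbIndex_lt_le {ν : ℕ} (h : M.SubgaussianLLR v a) (hA : IsControlPolicy A)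
    (hν : ν ≤ j * W + 1) (ha : a ∈ 𝒜) (hn : n ∈ window W j) {ε : ℝ} (hε : 0 < ε)
    (hE : MeasurableSet[history A (j * W)] E) :
    M.law ν 𝒜 (E ∩ {ω | M.ucbIndex v A W a n ω < ((M.KL a - ε : ℝ) : EReal)})
      ≤ (W : ℝ≥0∞)⁻¹ * M.law ν 𝒜 E := by
  have hs := windowStart_of_mem_window hn
  refine measure_inter_le_inv_of_subset_iUnion _ le_rfl
    (G := fun k => {ω | pulls A W a n ω = k ∧ M.meanReward A W a n ω
      ≤ ((M.KL a - ε - Real.sqrt (4 * v * Real.log W / k) : ℝ) : EReal)}) ?_ ?_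
  · intro ω hω
    simp only [Set.mem_ofPred_eq, ucbIndex] at hω
    split_ifs at hω with h0
    · exact absurd hω not_top_lt
    simp only [Set.mem_iUnion, Set.mem_ofPred_eq, Finset.mem_Icc]
    refine ⟨_, ⟨Nat.one_le_iff_ne_zero.2 h0, pulls_le_of_mem_window hn a ω⟩, rfl, ?_⟩
    rw [EReal.coe_sub]
    exact (EReal.le_sub_iff_add_le (by simp) (by simp)).2 hω.le
  · intro k hk
    obtain ⟨t, ht, hle⟩ := exists_chernoff_exponent v (Real.log_natCast_nonneg W) hε hk
    refine (measure_inter_meanReward_le_le h hA (one_le_of_mem_window hn) (hs ▸ hν) ha ht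
      (by rwa [hs]) hk _).trans ?_
    gcongr ENNReal.ofReal (Real.exp (-?_)) * _
    exact hle.trans_eq (by ring)

theorem measure_inter_le_pulls_and_le_meanReward_le {ν : ℕ∞} (hA : IsControlPolicy A)
    (hn : n ∈ window W j) {t q y : ℝ} (ht : 0 ≤ t) (hqy : q ≤ y)
    (hmom : ∀ i, j * W + 1 ≤ i → ∫⁻ x, M.likelihoodRatio a x ^ t ∂(M.obsLaw ν 𝒜 i a)
      ≤ ENNReal.ofReal (Real.exp (t * q)))
    (hE : MeasurableSet[history A (j * W)] E) {k₀ : ℕ} (hk₀ : 1 ≤ k₀)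
    (hle : 2 * Real.log W ≤ t * k₀ * (y - q)) :
    M.law ν 𝒜 (E ∩ {ω | k₀ ≤ pulls A W a n ω ∧ (y : EReal) ≤ M.meanReward A W a n ω})
      ≤ (W : ℝ≥0∞)⁻¹ * M.law ν 𝒜 E := by
  have hs := windowStart_of_mem_window hn
  refine measure_inter_le_inv_of_subset_iUnion _ hk₀
    (G := fun k => {ω | pulls A W a n ω = k ∧ (y : EReal) ≤ M.meanReward A W a n ω}) ?_ ?_
  · rintro ω ⟨hk, hy⟩
    simp only [Set.mem_iUnion, Set.mem_ofPred_eq, Finset.mem_Icc]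
    exact ⟨_, ⟨hk, pulls_le_of_mem_window hn a ω⟩, rfl, hy⟩
  · intro k hk
    refine (measure_inter_le_meanReward_le hA (one_le_of_mem_window hn) ht (by rwa [hs])
      (by rwa [hs]) (hk₀.trans hk) y).trans ?_
    have : 0 ≤ y - q := sub_nonneg.2 hqy
    gcongr ENNReal.ofReal (Real.exp (-?_)) * _
    exact hle.trans (by gcongr)

theorem sum_measure_inter_selected_of_pulls_lt_le (μ : Measure (Path K 𝓧))
    (hA : IsControlPolicy A) (W j k₀ : ℕ) (a : Fin K) (E : Set (Path K 𝓧)) :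
    ∑ n ∈ window W j, μ (E ∩ {ω | A n ω = a ∧ pulls A W a n ω < k₀}) ≤ k₀ * μ E := by
  have hmeas : ∀ n ∈ window W j, MeasurableSet {ω | A n ω = a ∧ pulls A W a n ω < k₀} :=
    fun n hn => hA.history_le (n - 1) _ <|
      (hA.measurableSet_action_eq (one_le_of_mem_window hn) (by omega) a).inter
        (hA.measurable_pulls W a n measurableSet_Iio)
  calc ∑ n ∈ window W j, μ (E ∩ {ω | A n ω = a ∧ pulls A W a n ω < k₀})
      = ∫⁻ ω in E, ∑ n ∈ window W j,
          {ω | A n ω = a ∧ pulls A W a n ω < k₀}.indicator 1 ω ∂μ := by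
        rw [lintegral_finsetSum' _ fun n hn =>
          (measurable_one.indicator (hmeas n hn)).aemeasurable]
        refine Finset.sum_congr rfl fun n hn => ?_
        rw [lintegral_indicator_one (hmeas n hn), Measure.restrict_apply (hmeas n hn),
          Set.inter_comm]
    _ ≤ ∫⁻ _ in E, (k₀ : ℝ≥0∞) ∂μ := by
        refine lintegral_mono fun ω => ?_
        have hcount : ∑ n ∈ window W j, {ω | A n ω = a ∧ pulls A W a n ω < k₀}.indicator
            (1 : Path K 𝓧 → ℝ≥0∞) ω = ((window W j).filter fun n => A n ω = a ∧
              ((Finset.Ico (j * W + 1) n).filter fun i => A i ω = a).card < k₀).card := by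
          rw [Finset.natCast_card_filter]
          refine Finset.sum_congr rfl fun n hn => ?_
          simp only [Set.indicator_apply, Set.mem_ofPred_eq, pulls, windowStart_of_mem_window hn,
            Pi.one_apply]
        rw [hcount]
        exact Nat.cast_le.2 (card_filter_and_card_filter_lt_le (fun i => A i ω = a) _ _ k₀)
    _ = k₀ * μ E := setLIntegral_const E _

theorem IsUCBPolicy.le_meanReward_of_selected (hA : M.IsUCBPolicy v W A) (hn : 1 ≤ n) {D ε : ℝ}
    (hε : 0 ≤ ε) {k₀ : ℕ} (hk₀ : 1 ≤ k₀) (hle : 4 * v * Real.log W ≤ ε ^ 2 * k₀) {ω : Path K 𝓧}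
    (hω : A n ω = a) (hpulls : k₀ ≤ pulls A W a n ω)
    (hidx : ((D - ε : ℝ) : EReal) ≤ M.ucbIndex v A W a' n ω) :
    ((D - 2 * ε : ℝ) : EReal) ≤ M.meanReward A W a n ω := by
  have hmax := hidx.trans (hA.argmax n hn ω a')
  rw [hω, ucbIndex, if_neg (by omega)] at hmax
  have hpos : (0 : ℝ) < pulls A W a n ω := by exact_mod_cast hk₀.trans hpulls
  have hradius : Real.sqrt (4 * v * Real.log W / pulls A W a n ω) ≤ ε := by
    rw [Real.sqrt_le_left hε, div_le_iff₀ hpos]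
    exact hle.trans (by gcongr)
  refine le_trans ?_ (EReal.sub_le_of_le_add hmax)
  rw [← EReal.coe_sub, EReal.coe_le_coe_iff]
  linarith

theorem IsUCBPolicy.measure_inter_selected_le {ν : ℕ} (hA : M.IsUCBPolicy v W A)
    (h : M.SubgaussianLLR v a') (ha' : a' ∈ 𝒜) (hν : ν ≤ j * W + 1) (hn : n ∈ window W j)
    {t q ε : ℝ} (ht : 0 ≤ t) (hε : 0 < ε) (hq : q + 4 * ε = M.KL a')
    (hmom : ∀ i, ν ≤ i → ∫⁻ x, M.likelihoodRatio a x ^ t ∂(M.obsLaw ν 𝒜 i a)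
      ≤ ENNReal.ofReal (Real.exp (t * q)))
    {k₀ : ℕ} (hk₀ : 1 ≤ k₀) (hk₁ : 4 * v * Real.log W ≤ ε ^ 2 * k₀)
    (hk₂ : Real.log W ≤ t * ε * k₀) (hE : MeasurableSet[history A (j * W)] E) :
    M.law ν 𝒜 (E ∩ {ω | A n ω = a})
      ≤ M.law ν 𝒜 (E ∩ {ω | A n ω = a ∧ pulls A W a n ω < k₀})
        + 2 * ((W : ℝ≥0∞)⁻¹ * M.law ν 𝒜 E) := by
  set few : Set (Path K 𝓧) := {ω | A n ω = a ∧ pulls A W a n ω < k₀}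
  set low : Set (Path K 𝓧) := {ω | M.ucbIndex v A W a' n ω < ((M.KL a' - ε : ℝ) : EReal)}
  set high : Set (Path K 𝓧) := {ω | k₀ ≤ pulls A W a n ω ∧
    ((M.KL a' - 2 * ε : ℝ) : EReal) ≤ M.meanReward A W a n ω}
  have hcover : E ∩ {ω | A n ω = a} ⊆ E ∩ few ∪ (E ∩ low ∪ E ∩ high) := by
    rintro ω ⟨hωE, hω⟩
    rcases lt_or_ge (pulls A W a n ω) k₀ with hk | hk
    · exact Or.inl ⟨hωE, hω, hk⟩
    rcases lt_or_ge (M.ucbIndex v A W a' n ω) ((M.KL a' - ε : ℝ) : EReal) with hidx | hidx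
    · exact Or.inr (Or.inl ⟨hωE, hidx⟩)
    · exact Or.inr (Or.inr ⟨hωE, hk,
        hA.le_meanReward_of_selected (one_le_of_mem_window hn) hε.le hk₀ hk₁ hω hk hidx⟩)
  have hlow := measure_inter_ucbIndex_lt_le h hA.isControlPolicy hν ha' hn hε hE
  have hhigh := measure_inter_le_pulls_and_le_meanReward_le (M := M) (ν := ν) (𝒜 := 𝒜)
    (y := M.KL a' - 2 * ε) hA.isControlPolicy hn ht (by linarith)
    (fun i hi => hmom i (hν.trans hi)) hE hk₀ (by rw [← hq]; linarith)
  calc M.law ν 𝒜 (E ∩ {ω | A n ω = a})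
      ≤ M.law ν 𝒜 (E ∩ few) + (M.law ν 𝒜 (E ∩ low) + M.law ν 𝒜 (E ∩ high)) :=
        (measure_mono hcover).trans ((measure_union_le _ _).trans
          (add_le_add_right (measure_union_le _ _) _))
    _ ≤ _ := by rw [two_mul]; gcongr

theorem IsUCBPolicy.sum_measure_selected_le {ν : ℕ} (hA : M.IsUCBPolicy v W A)
    (h : M.SubgaussianLLR v a') (ha' : a' ∈ 𝒜) (hν : ν ≤ j * W + 1) {t q ε : ℝ} (ht : 0 ≤ t)
    (hε : 0 < ε) (hq : q + 4 * ε = M.KL a')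
    (hmom : ∀ i, ν ≤ i → ∫⁻ x, M.likelihoodRatio a x ^ t ∂(M.obsLaw ν 𝒜 i a)
      ≤ ENNReal.ofReal (Real.exp (t * q)))
    {k₀ : ℕ} (hk₀ : 1 ≤ k₀) (hk₁ : 4 * v * Real.log W ≤ ε ^ 2 * k₀)
    (hk₂ : Real.log W ≤ t * ε * k₀) (hE : MeasurableSet[history A (j * W)] E) :
    ∑ n ∈ window W j, M.law ν 𝒜 (E ∩ {ω | A n ω = a}) ≤ (k₀ + 2) * M.law ν 𝒜 E :=
  calc ∑ n ∈ window W j, M.law ν 𝒜 (E ∩ {ω | A n ω = a})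
      ≤ ∑ n ∈ window W j, (M.law ν 𝒜 (E ∩ {ω | A n ω = a ∧ pulls A W a n ω < k₀})
          + 2 * ((W : ℝ≥0∞)⁻¹ * M.law ν 𝒜 E)) := Finset.sum_le_sum fun n hn =>
        hA.measure_inter_selected_le h ha' hν hn ht hε hq hmom hk₀ hk₁ hk₂ hE
    _ ≤ k₀ * M.law ν 𝒜 E + W * (2 * ((W : ℝ≥0∞)⁻¹ * M.law ν 𝒜 E)) := by
        rw [Finset.sum_add_distrib, Finset.sum_const, card_window, nsmul_eq_mul]
        gcongr
        exact sum_measure_inter_selected_of_pulls_lt_le _ hA.isControlPolicy W j k₀ a E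
    _ = k₀ * M.law ν 𝒜 E + W * (W : ℝ≥0∞)⁻¹ * (2 * M.law ν 𝒜 E) := by ring
    _ ≤ k₀ * M.law ν 𝒜 E + 1 * (2 * M.law ν 𝒜 E) := by
        gcongr; exact ENNReal.mul_inv_le_one _
    _ = (k₀ + 2) * M.law ν 𝒜 E := by ring

theorem exists_lintegral_likelihoodRatio_rpow_le {D : ℝ} (hD : 0 < D)
    (h : a ∈ 𝒜 → M.SubgaussianLLR v a ∧ M.KL a < D) :
    ∃ t q : ℝ, 0 < t ∧ q < D ∧ ∀ ν i : ℕ, ν ≤ i →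
      ∫⁻ x, M.likelihoodRatio a x ^ t ∂(M.obsLaw ν 𝒜 i a) ≤ ENNReal.ofReal (Real.exp (t * q)) := by
  by_cases ha : a ∈ 𝒜
  · obtain ⟨hsub, hlt⟩ := h ha
    set t := (D - M.KL a) / (v + 1)
    have ht : 0 < t := div_pos (sub_pos.2 hlt) (by positivity)
    have hvt : t * (v + 1) = D - M.KL a := div_mul_cancel₀ _ (by positivity)
    refine ⟨t, M.KL a + v * t / 2, ht, ?_, fun ν i hi => ?_⟩
    · nlinarith [mul_nonneg v.2 ht.le]
    · rw [obsLaw_of_mem hi ha]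
      exact hsub.lintegral_likelihoodRatio_rpow_le t
  · refine ⟨1, 0, one_pos, hD, fun ν i _ => ?_⟩
    rw [obsLaw_of_notMem ha]
    simpa using M.lintegral_likelihoodRatio_pre_le a

theorem exists_sum_measureReal_selected_le (h : M.SubgaussianLLR v a') (ha' : a' ∈ 𝒜)
    (hD : 0 < M.KL a') (hlt : a ∈ 𝒜 → M.SubgaussianLLR v a ∧ M.KL a < M.KL a') :
    ∃ C : ℝ, 0 ≤ C ∧ ∀ (W : ℕ) (A : ℕ → Path K 𝓧 → Fin K) (ν j : ℕ),
      M.IsUCBPolicy v W A → ν ≤ j * W + 1 → ∀ E, MeasurableSet[history A (j * W)] E →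
        ∑ n ∈ window W j, (M.law ν 𝒜).real (E ∩ {ω | A n ω = a})
          ≤ C * (Real.log W + 1) * (M.law ν 𝒜).real E := by
  obtain ⟨t, q, ht, hq, hmom⟩ := exists_lintegral_likelihoodRatio_rpow_le hD hlt
  set ε := (M.KL a' - q) / 4
  have hε : 0 < ε := div_pos (sub_pos.2 hq) (by norm_num)
  set C := 4 * v / ε ^ 2 + 1 / (t * ε)
  have hC : 0 ≤ C := by positivity
  have hCv : 4 * v ≤ ε ^ 2 * C :=
    calc 4 * (v : ℝ) = ε ^ 2 * (4 * v / ε ^ 2) := by field_simp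
      _ ≤ ε ^ 2 * C := by gcongr; exact le_add_of_nonneg_right (by positivity)
  have hCt : 1 ≤ t * ε * C :=
    calc (1 : ℝ) = t * ε * (1 / (t * ε)) := by field_simp
      _ ≤ t * ε * C := by gcongr; exact le_add_of_nonneg_left (by positivity)
  refine ⟨C + 4, by positivity, fun W A ν j hA hν E hE => ?_⟩
  have hL : 0 ≤ Real.log W := Real.log_natCast_nonneg W
  set k₀ := ⌈C * Real.log W⌉₊ + 1 with hk₀
  have hk : C * Real.log W ≤ k₀ := (Nat.le_ceil _).trans (by simp [hk₀])
  have hk' : (k₀ : ℝ) + 2 ≤ (C + 4) * (Real.log W + 1) := by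
    rw [hk₀]; push_cast
    nlinarith [Nat.ceil_lt_add_one (mul_nonneg hC hL)]
  have hsum := hA.sum_measure_selected_le h ha' hν ht.le hε (by ring) (hmom ν) (k₀ := k₀)
    (by omega)
    (calc 4 * v * Real.log W ≤ ε ^ 2 * C * Real.log W := by gcongr
      _ ≤ ε ^ 2 * k₀ := by rw [mul_assoc]; gcongr)
    (calc Real.log W ≤ t * ε * C * Real.log W := le_mul_of_one_le_left hL hCt
      _ ≤ t * ε * k₀ := by rw [mul_assoc _ C]; gcongr) hE
  have hreal := ENNReal.toReal_mono (by finiteness) hsum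
  rw [ENNReal.toReal_sum (fun n _ => by finiteness), ENNReal.toReal_mul,
    ENNReal.toReal_add (by finiteness) (by finiteness), ENNReal.toReal_natCast,
    ENNReal.toReal_ofNat] at hreal
  exact hreal.trans (mul_le_mul_of_nonneg_right hk' measureReal_nonneg)

theorem sum_measureReal_inter_selected (μ : Measure (Path K 𝓧)) [IsFiniteMeasure μ]
    (hA : IsControlPolicy A) (hn : 1 ≤ n) (E : Set (Path K 𝓧)) :
    ∑ a, μ.real (E ∩ {ω | A n ω = a}) = μ.real E := by
  have hmeas (a : Fin K) : MeasurableSet (A n ⁻¹' {a}) :=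
    hA.history_le (n - 1) _ (hA.measurableSet_action_eq hn (by omega) a)
  calc ∑ a, μ.real (E ∩ {ω | A n ω = a}) = ∑ a, (μ.restrict E).real (A n ⁻¹' {a}) :=
        Finset.sum_congr rfl fun a _ => by
          rw [measureReal_restrict_apply (hmeas a), Set.inter_comm]; rfl
    _ = (μ.restrict E).real (A n ⁻¹' (Finset.univ : Finset (Fin K))) :=
        sum_measureReal_preimage_singleton _ fun a _ => hmeas a
    _ = μ.real E := by simp

theorem exists_le_sum_measureReal_selected (h : ∀ a ∈ 𝒜, M.SubgaussianLLR v a) (ha' : a' ∈ 𝒜)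
    (hD : 0 < M.KL a') (hmax : ∀ a ∈ 𝒜, a ≠ a' → M.KL a < M.KL a') :
    ∃ C : ℝ, ∀ (W : ℕ) (A : ℕ → Path K 𝓧 → Fin K) (ν j : ℕ),
      M.IsUCBPolicy v W A → ν ≤ j * W + 1 → ∀ E, MeasurableSet[history A (j * W)] E →
        (W - C * (Real.log W + 1)) * (M.law ν 𝒜).real E
          ≤ ∑ n ∈ window W j, (M.law ν 𝒜).real (E ∩ {ω | A n ω = a'}) := by
  have harm (a : Fin K) : ∃ C : ℝ, a ≠ a' → 0 ≤ C ∧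
      ∀ (W : ℕ) (A : ℕ → Path K 𝓧 → Fin K) (ν j : ℕ),
      M.IsUCBPolicy v W A → ν ≤ j * W + 1 → ∀ E, MeasurableSet[history A (j * W)] E →
        ∑ n ∈ window W j, (M.law ν 𝒜).real (E ∩ {ω | A n ω = a})
          ≤ C * (Real.log W + 1) * (M.law ν 𝒜).real E := by
    by_cases hne : a = a'
    · exact ⟨0, fun hne' => absurd hne hne'⟩
    · obtain ⟨C, hC⟩ := exists_sum_measureReal_selected_le (h a' ha') ha' hD
        fun ha => ⟨h a ha, hmax a ha hne⟩
      exact ⟨C, fun _ => hC⟩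
  choose C hC using harm
  refine ⟨∑ a ∈ Finset.univ.erase a', C a, fun W A ν j hA hν E hE => ?_⟩
  have hbad : ∑ a ∈ Finset.univ.erase a', ∑ n ∈ window W j,
      (M.law ν 𝒜).real (E ∩ {ω | A n ω = a})
      ≤ (∑ a ∈ Finset.univ.erase a', C a) * (Real.log W + 1) * (M.law ν 𝒜).real E := by
    rw [Finset.sum_mul, Finset.sum_mul]
    exact Finset.sum_le_sum fun a ha => (hC a (Finset.ne_of_mem_erase ha)).2 W A ν j hA hν E hE
  have htotal : W * (M.law ν 𝒜).real E
      = ∑ a, ∑ n ∈ window W j, (M.law ν 𝒜).real (E ∩ {ω | A n ω = a}) := by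
    rw [Finset.sum_comm, Finset.sum_congr rfl fun n hn => sum_measureReal_inter_selected _
      hA.isControlPolicy (one_le_of_mem_window hn) E, Finset.sum_const, card_window, nsmul_eq_mul]
  rw [← Finset.add_sum_erase _ _ (Finset.mem_univ a')] at htotal
  linarith

end UCB

section WindowReward

variable {M : BanditQCD K 𝓧} {A : ℕ → Path K 𝓧 → Fin K} {𝒜 : Finset (Fin K)} {a : Fin K}
  {φ : 𝓧 → ℝ}

/-- The total reward collected from action `a` in the `j`-th interval of length `W`, when
selecting `a` and observing `x` earns `φ x`. -/
def windowReward {𝓧 : Type*} (A : ℕ → Path K 𝓧 → Fin K) (W : ℕ) (a : Fin K) (φ : 𝓧 → ℝ) (j : ℕ)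
    (ω : Path K 𝓧) : ℝ :=
  ∑ n ∈ window W j, if A n ω = a then φ (ω n a) else 0

theorem sum_windowReward {𝓧 : Type*} (A : ℕ → Path K 𝓧 → Fin K) (W : ℕ) (a : Fin K) (φ : 𝓧 → ℝ)
    (j₀ J : ℕ) (ω : Path K 𝓧) :
    ∑ j ∈ Finset.range J, windowReward A W a φ (j₀ + j) ω
      = ∑ n ∈ Finset.Ico (j₀ * W + 1) ((j₀ + J) * W + 1), if A n ω = a then φ (ω n a) else 0 := by
  induction J with
  | zero => simp
  | succ J ih =>
    have hend : (j₀ + (J + 1)) * W + 1 = (j₀ + J) * W + 1 + W := by ring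
    rw [Finset.sum_range_succ, ih, windowReward, window, hend,
      Finset.sum_Ico_consecutive _ (by gcongr; omega) (by omega)]

theorem windowReward_le {𝓧 : Type*} (A : ℕ → Path K 𝓧 → Fin K) (W : ℕ) (a : Fin K) {φ : 𝓧 → ℝ}
    {B : ℝ} (hB : 0 ≤ B) (hφ : ∀ x, φ x ≤ B) (j : ℕ) (ω : Path K 𝓧) :
    windowReward A W a φ j ω ≤ B * W := by
  refine (Finset.sum_le_card_nsmul _ _ B fun n _ => ?_).trans_eq ?_
  · split_ifs
    exacts [hφ _, hB]
  · rw [card_window, nsmul_eq_mul, mul_comm]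

theorem integrable_ite_selected {ν : ℕ∞} (hA : IsControlPolicy A) {n : ℕ} (hn : 1 ≤ n)
    (hφ : Integrable φ (M.obsLaw ν 𝒜 n a)) :
    Integrable (fun ω => if A n ω = a then φ (ω n a) else 0) (M.law ν 𝒜) := by
  have h := ((M.measurePreserving_obs ν 𝒜 n a).integrable_comp_of_integrable hφ).indicator
    (hA.history_le (n - 1) _ (hA.measurableSet_action_eq hn (by omega) a))
  refine h.congr (ae_of_all _ fun ω => ?_)
  simp only [Set.indicator_apply, Set.mem_ofPred_eq, Function.comp_apply]

theorem integrable_windowReward {ν : ℕ∞} (hA : IsControlPolicy A) {W j : ℕ}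
    (hφ : ∀ n ∈ window W j, Integrable φ (M.obsLaw ν 𝒜 n a)) :
    Integrable (windowReward A W a φ j) (M.law ν 𝒜) :=
  integrable_finsetSum _ fun n hn =>
    integrable_ite_selected hA (one_le_of_mem_window hn) (hφ n hn)

theorem setIntegral_windowReward {ν : ℕ∞} (hA : IsControlPolicy A) {W j : ℕ} {E : Set (Path K 𝓧)}
    (hE : MeasurableSet[history A (j * W)] E) (hφm : Measurable φ)
    (hφ : ∀ n ∈ window W j, Integrable φ (M.obsLaw ν 𝒜 n a)) :
    ∫ ω in E, windowReward A W a φ j ω ∂(M.law ν 𝒜)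
      = ∑ n ∈ window W j, (M.law ν 𝒜).real (E ∩ {ω | A n ω = a})
          * ∫ x, φ x ∂(M.obsLaw ν 𝒜 n a) := by
  simp only [windowReward]
  rw [integral_finsetSum _ fun n hn =>
    (integrable_ite_selected hA (one_le_of_mem_window hn) (hφ n hn)).integrableOn]
  refine Finset.sum_congr rfl fun n hn => ?_
  have hsel : MeasurableSet[history A (n - 1)] {ω | A n ω = a} :=
    hA.measurableSet_action_eq (one_le_of_mem_window hn) (by omega) a
  have hpast : j * W ≤ n - 1 := Nat.le_sub_one_of_lt (mem_window.1 hn).1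
  rw [← M.setIntegral_obs hA (one_le_of_mem_window hn) a ((history_mono A hpast _ hE).inter hsel)
    hφm, ← setIntegral_indicator (hA.history_le _ _ hsel)]
  simp only [Set.indicator_apply, Set.mem_ofPred_eq]

theorem coe_sum_LLR_le_max_cusum {ω : Path K 𝓧} {m n : ℕ} (hmn : m ≤ n)
    (hω : ∀ i, m < i → ((M.LLR a (ω i a)).toReal : EReal) = M.LLR a (ω i a)) :
    ((∑ i ∈ Finset.Ico (m + 1) (n + 1), if A i ω = a then (M.LLR a (ω i a)).toReal else 0 : ℝ) :
      EReal) ≤ max (M.cusum A a n ω) 0 := by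
  induction n, hmn using Nat.le_induction with
  | base => simp
  | succ n hn ih =>
    rw [Finset.sum_Ico_succ_top (by omega), cusum]
    split_ifs with h
    · rw [EReal.coe_add, hω (n + 1) (by omega)]
      exact le_max_of_le_left (add_le_add_left ih _)
    · rwa [add_zero]

theorem sum_LLR_le_of_lt_alarm {b : ℝ} (hb : 0 ≤ b) {ω : Path K 𝓧} {m n : ℕ} (hmn : m ≤ n)
    (hω : ∀ i, m < i → ((M.LLR a (ω i a)).toReal : EReal) = M.LLR a (ω i a))
    (hn : (n : ℕ∞) < M.alarm A b ω) :
    ∑ i ∈ Finset.Ico (m + 1) (n + 1), (if A i ω = a then (M.LLR a (ω i a)).toReal else 0) ≤ b := by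
  have hcusum : max (M.cusum A a n ω) 0 ≤ b := by
    refine max_le ?_ (EReal.coe_nonneg.2 hb)
    rcases n.eq_zero_or_pos with rfl | hpos
    · exact EReal.coe_nonneg.2 hb
    · exact (M.lt_alarm_iff.1 hn n hpos le_rfl a).le
  exact EReal.coe_le_coe_iff.1 ((coe_sum_LLR_le_max_cusum hmn hω).trans hcusum)

theorem sum_indicator_lt_alarm_windowReward_le {W j₀ : ℕ} {B b : ℝ} (hB : 0 ≤ B) (hb : 0 ≤ b)
    {ω : Path K 𝓧} (hω : ∀ i, j₀ * W < i → ((M.LLR a (ω i a)).toReal : EReal) = M.LLR a (ω i a))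
    (J : ℕ) :
    ∑ j ∈ Finset.range J, {ω | (((j₀ + j) * W : ℕ) : ℕ∞) < M.alarm A b ω}.indicator
      (windowReward A W a (fun x => min (M.LLR a x).toReal B) (j₀ + j)) ω ≤ b + B * W := by
  induction J with
  | zero => simp only [Finset.range_zero, Finset.sum_empty]; positivity
  | succ J ih =>
    by_cases hJ : (((j₀ + J) * W : ℕ) : ℕ∞) < M.alarm A b ω
    · have hrunning : ∀ j ∈ Finset.range (J + 1),
          ω ∈ {ω | (((j₀ + j) * W : ℕ) : ℕ∞) < M.alarm A b ω} := fun j hj => by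
        have hle : (j₀ + j) * W ≤ (j₀ + J) * W := by
          gcongr
          exact Finset.mem_range_succ_iff.1 hj
        exact lt_of_le_of_lt (Nat.cast_le.2 hle) hJ
      rw [Finset.sum_congr rfl fun j hj => Set.indicator_of_mem (hrunning j hj) _,
        Finset.sum_range_succ, sum_windowReward]
      gcongr ?_ + ?_
      · refine le_trans (Finset.sum_le_sum fun i _ => ?_)
          (sum_LLR_le_of_lt_alarm hb (by gcongr; omega) hω hJ)
        split_ifs
        exacts [min_le_left _ _, le_rfl]
      · exact windowReward_le A W a hB (fun _ => min_le_right _ _) _ ω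
    · have hstopped : ω ∉ {ω | (((j₀ + J) * W : ℕ) : ℕ∞) < M.alarm A b ω} := hJ
      rwa [Finset.sum_range_succ, Set.indicator_of_notMem hstopped, add_zero]

end WindowReward

section Delay

variable {M : BanditQCD K 𝓧} {A : ℕ → Path K 𝓧 → Fin K} {W : ℕ} {𝒜 : Finset (Fin K)}
  {a : Fin K} {B b u : ℝ}

theorem worstCaseDelay_le (hA : IsControlPolicy A) {T : Path K 𝓧 → ℕ∞} {c : ℝ≥0∞}
    (h : ∀ ν : ℕ, 1 ≤ ν → ∀ H, MeasurableSet[history A (ν - 1)] H →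
      ∫⁻ ω in H, ((T ω + 1 - ν : ℕ∞) : ℝ≥0∞) ∂(M.law ν 𝒜) ≤ c * M.law ν 𝒜 H) :
    M.worstCaseDelay 𝒜 A T ≤ c := by
  refine iSup₂_le fun ν hν => essSup_le_of_ae_le c ?_
  have hm := hA.history_le (ν - 1)
  refine ae_le_of_ae_le_trim (hm := hm) ?_
  refine ae_le_of_forall_setLIntegral_le_of_sigmaFinite (μ := (M.law ν 𝒜).trim hm)
    (measurable_condLExp _ _ _) fun H hH _ => ?_
  rw [setLIntegral_condLExp_trim hm _ _ hH, setLIntegral_const, trim_measurableSet_eq hm hH]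
  exact h ν hν H hH

theorem tsum_measure_inter_lt_alarm_le {ν j₀ : ℕ} (hA : IsControlPolicy A)
    (hac : M.post a ≪ M.pre a) (hLLR : Integrable (fun x => (M.LLR a x).toReal) (M.post a))
    (ha : a ∈ 𝒜) (hν : ν ≤ j₀ * W + 1) (hB : 0 ≤ B) (hb : 0 ≤ b)
    (hμ : 0 < ∫ x, min (M.LLR a x).toReal B ∂(M.post a)) (hu : 0 < u)
    (hsel : ∀ j, j₀ ≤ j → ∀ E, MeasurableSet[history A (j * W)] E →
      u * (M.law ν 𝒜).real E ≤ ∑ n ∈ window W j, (M.law ν 𝒜).real (E ∩ {ω | A n ω = a}))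
    {H : Set (Path K 𝓧)} (hH : MeasurableSet[history A (j₀ * W)] H) :
    ∑' j : ℕ, M.law ν 𝒜 (H ∩ {ω | (((j₀ + j) * W : ℕ) : ℕ∞) < M.alarm A b ω})
      ≤ ENNReal.ofReal ((b + B * W) / (u * ∫ x, min (M.LLR a x).toReal B ∂(M.post a)))
        * M.law ν 𝒜 H := by
  set P := M.law ν 𝒜
  set φ : 𝓧 → ℝ := fun x => min (M.LLR a x).toReal B
  have hφ (j n : ℕ) (hn : n ∈ window W (j₀ + j)) : M.obsLaw ν 𝒜 n a = M.post a := by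
    have hstart : j₀ * W ≤ (j₀ + j) * W := by gcongr; omega
    exact obsLaw_of_mem (by exact_mod_cast (by have := (mem_window.1 hn).1; omega : ν ≤ n)) ha
  have hφint (j n : ℕ) (hn : n ∈ window W (j₀ + j)) : Integrable φ (M.obsLaw ν 𝒜 n a) := by
    rw [hφ j n hn]
    exact hLLR.inf (integrable_const B)
  set G : ℕ → Set (Path K 𝓧) := fun j => {ω | (((j₀ + j) * W : ℕ) : ℕ∞) < M.alarm A b ω}
  have hG (j : ℕ) : MeasurableSet[history A ((j₀ + j) * W)] (G j) := M.measurableSet_lt_alarm hA b _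
  have hG' (j : ℕ) := hA.history_le _ _ (hG j)
  have hdrift (j : ℕ) : u * (∫ x, φ x ∂(M.post a)) * (P.restrict H).real (G j)
      ≤ ∫ ω in G j, windowReward A W a φ (j₀ + j) ω ∂(P.restrict H) := by
    have hGH : MeasurableSet[history A ((j₀ + j) * W)] (G j ∩ H) :=
      (hG j).inter (history_mono A (by gcongr; omega) _ hH)
    rw [Measure.restrict_restrict (hG' j), measureReal_restrict_apply (hG' j),
      setIntegral_windowReward hA hGH ((M.measurable_toReal_LLR a).min measurable_const) (hφint j),
      Finset.sum_congr rfl fun n hn => by rw [hφ j n hn], ← Finset.sum_mul, mul_right_comm]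
    gcongr
    exact hsel _ (by omega) _ hGH
  have hbound (J : ℕ) : ∀ᵐ ω ∂(P.restrict H), ∑ j ∈ Finset.range J,
      (G j).indicator (windowReward A W a φ (j₀ + j)) ω ≤ b + B * W := by
    filter_upwards [ae_restrict_of_ae (ae_forall_obs_of_ae_post (ae_coe_toReal_LLR hac) ν ha)]
      with ω hω
    exact sum_indicator_lt_alarm_windowReward_le hB hb (fun i hi => hω i (by omega)) J
  have h := tsum_measure_le_of_le_setIntegral hG'
    (fun j => (integrable_windowReward hA (hφint j)).restrict) (mul_pos hu hμ) hdrift hbound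
  simpa only [Measure.restrict_apply (hG' _), Set.inter_comm, Measure.restrict_apply_univ] using h

theorem worstCaseDelay_alarm_le (hA : IsControlPolicy A) (hW : 1 ≤ W)
    (hac : M.post a ≪ M.pre a) (hLLR : Integrable (fun x => (M.LLR a x).toReal) (M.post a))
    (ha : a ∈ 𝒜) (hB : 0 ≤ B) (hb : 0 ≤ b)
    (hμ : 0 < ∫ x, min (M.LLR a x).toReal B ∂(M.post a)) (hu : 0 < u)
    (hsel : ∀ ν j : ℕ, ν ≤ j * W + 1 → ∀ E, MeasurableSet[history A (j * W)] E →
      u * (M.law ν 𝒜).real E ≤ ∑ n ∈ window W j, (M.law ν 𝒜).real (E ∩ {ω | A n ω = a})) :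
    M.worstCaseDelay 𝒜 A (M.alarm A b) ≤ ENNReal.ofReal
      (W + W * ((b + B * W) / (u * ∫ x, min (M.LLR a x).toReal B ∂(M.post a)))) := by
  refine worstCaseDelay_le hA fun ν hν H hH => ?_
  set j₀ := (ν - 1) / W + 1 with hj₀
  have hlow : ν ≤ j₀ * W := by
    have := Nat.lt_div_mul_add (a := ν - 1) hW
    rw [hj₀, Nat.add_mul]; omega
  have hupp : j₀ * W + 1 ≤ ν + W := by
    have := Nat.div_mul_le_self (ν - 1) W
    rw [hj₀, Nat.add_mul]; omega
  have hT (n : ℕ) : MeasurableSet {ω | (n : ℕ∞) < M.alarm A b ω} :=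
    hA.history_le _ _ (M.measurableSet_lt_alarm hA b n)
  set q := (b + B * W) / (u * ∫ x, min (M.LLR a x).toReal B ∂(M.post a))
  have : 0 ≤ q := by positivity
  calc ∫⁻ ω in H, ((M.alarm A b ω + 1 - ν : ℕ∞) : ℝ≥0∞) ∂(M.law ν 𝒜)
      ≤ W * M.law ν 𝒜 H + W * ∑' j : ℕ,
          M.law ν 𝒜 (H ∩ {ω | (((j₀ + j) * W : ℕ) : ℕ∞) < M.alarm A b ω}) := by
        simpa only [Measure.restrict_apply (hT _), Set.inter_comm, Measure.restrict_apply_univ,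
          ← Nat.add_mul] using lintegral_delay_le ((M.law ν 𝒜).restrict H) hT hW hupp
    _ ≤ W * M.law ν 𝒜 H + W * (ENNReal.ofReal q * M.law ν 𝒜 H) := by
        gcongr
        refine tsum_measure_inter_lt_alarm_le hA hac hLLR ha (by omega) hB hb hμ hu
          (fun j hj => hsel ν j ?_) (history_mono A (by omega) _ hH)
        have : j₀ * W ≤ j * W := by gcongr
        omega
    _ = ENNReal.ofReal (W + W * q) * M.law ν 𝒜 H := by
        rw [ENNReal.ofReal_add (by positivity) (by positivity),
          ENNReal.ofReal_mul (by positivity), ENNReal.ofReal_natCast]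
        ring

end Delay

variable {M : BanditQCD K 𝓧} {v : ℝ≥0} {𝒜 : Finset (Fin K)} {a : Fin K}

theorem exists_eventually_worstCaseDelay_le (h : ∀ a ∈ 𝒜, M.SubgaussianLLR v a) (ha : a ∈ 𝒜)
    (hmax : ∀ a' ∈ 𝒜, a' ≠ a → M.KL a' < M.KL a) {y : ℝ} (hy : 0 < y) (hyD : y < M.KL a) :
    ∃ B : ℝ, ∀ᶠ W : ℕ in atTop, ∀ (A : ℕ → Path K 𝓧 → Fin K) (b : ℝ),
      M.IsUCBPolicy v W A → 0 ≤ b →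
        M.worstCaseDelay 𝒜 A (M.alarm A b) ≤ ENNReal.ofReal (W + (b + B * W) / y) := by
  obtain ⟨B, hB, hlt⟩ := exists_lt_integral_min (h a ha).integrable_LLR hyD
  obtain ⟨C, hsel⟩ := exists_le_sum_measureReal_selected h ha (hy.trans hyD) hmax
  have hμ := hy.trans hlt
  refine ⟨B, ?_⟩
  filter_upwards [eventually_mul_le_sub_log_mul C hμ hlt, eventually_ge_atTop 1]
    with W hdrift hW A b hA hb
  have hW' : (0 : ℝ) < W := by exact_mod_cast hW
  have hWy : 0 < W * y := mul_pos hW' hy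
  refine (worstCaseDelay_alarm_le hA.isControlPolicy hW (h a ha).ac (h a ha).integrable_LLR ha hB
    hb hμ (pos_of_mul_pos_left (hWy.trans_le hdrift) hμ.le)
    fun ν j hν => hsel W A ν j hA hν).trans (ENNReal.ofReal_le_ofReal ?_)
  calc W + W * ((b + B * W) / ((W - C * (Real.log W + 1))
          * ∫ x, min (M.LLR a x).toReal B ∂(M.post a)))
      ≤ W + W * ((b + B * W) / (W * y)) := by gcongr
    _ = W + (b + B * W) / y := by field_simp

theorem eventually_worstCaseDelay_le (h : ∀ a ∈ 𝒜, M.SubgaussianLLR v a) (ha : a ∈ 𝒜)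
    (hD : 0 < M.KL a) (hmax : ∀ a' ∈ 𝒜, a' ≠ a → M.KL a' < M.KL a) {ι : Type*} {l : Filter ι}
    {b : ι → ℝ} {W : ι → ℕ} {A : ι → ℕ → Path K 𝓧 → Fin K} (hb : Tendsto b l atTop)
    (hW : Tendsto W l atTop) (hWb : (fun i => (W i : ℝ)) =o[l] b)
    (hA : ∀ i, M.IsUCBPolicy v (W i) (A i)) {η : ℝ} (hη : 0 < η) :
    ∀ᶠ i in l, M.worstCaseDelay 𝒜 (A i) (M.alarm (A i) (b i))
      ≤ ENNReal.ofReal (b i / M.KL a * (1 + η)) := by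
  set D := M.KL a
  set y := D / (1 + η / 2) with hy
  obtain ⟨B, hB⟩ := exists_eventually_worstCaseDelay_le h ha hmax (y := y) (by positivity)
    (div_lt_self hD (by linarith))
  have hsmall : (fun i => (1 + B / y) * W i) =o[l] b := hWb.const_mul_left _
  filter_upwards [hW.eventually hB, hb.eventually_ge_atTop 0,
    hsmall.def (show 0 < η / (2 * D) by positivity)] with i hi hbi hWi
  refine (hi (A i) (b i) (hA i) hbi).trans (ENNReal.ofReal_le_ofReal ?_)
  rw [Real.norm_eq_abs, Real.norm_eq_abs, abs_of_nonneg hbi] at hWi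
  calc W i + (b i + B * W i) / y = (1 + B / y) * W i + b i / y := by ring
    _ ≤ η / (2 * D) * b i + b i / y := by gcongr ?_ + _; exact (le_abs_self _).trans hWi
    _ = b i / D * (1 + η) := by rw [hy]; field_simp; ring

end BanditQCD

theorem theorem2_general {K : ℕ} {𝓧 : Type*} [MeasurableSpace 𝓧] (M : BanditQCD K 𝓧) :
    (∀ (A : ℕ → BanditQCD.Path K 𝓧 → Fin K) (b : ℝ), BanditQCD.IsControlPolicy A →
      ENNReal.ofReal (Real.exp b) ≤ M.meanTimeToFalseAlarm (M.alarm A b)) ∧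
    (∀ (v : ℝ≥0) (𝒜 : Finset (Fin K)) (h𝒜 : 𝒜.Nonempty), (∀ a ∈ 𝒜, M.SubgaussianLLR v a) →
      0 < M.maxKL 𝒜 h𝒜 → (∃! a, a ∈ 𝒜 ∧ M.KL a = M.maxKL 𝒜 h𝒜) →
      ∀ {ι : Type*} (l : Filter ι) (b : ι → ℝ) (W : ι → ℕ) (A : ι → ℕ → BanditQCD.Path K 𝓧 → Fin K),
        Tendsto b l atTop → Tendsto W l atTop → ((fun i => (W i : ℝ)) =o[l] b) →
        (∀ i, M.IsUCBPolicy v (W i) (A i)) →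
        ∃ r : ι → ℝ, Tendsto r l (𝓝 0) ∧ ∀ᶠ i in l,
          M.worstCaseDelay 𝒜 (A i) (M.alarm (A i) (b i))
            ≤ ENNReal.ofReal (b i / M.maxKL 𝒜 h𝒜 * (1 + r i))) := by
  refine ⟨fun A b hA => M.exp_le_meanTimeToFalseAlarm hA b, ?_⟩
  rintro v 𝒜 h𝒜 hsub hD ⟨a, ⟨ha, hKL⟩, huniq⟩ ι l b W A hb hW hWb hA
  have hmax : ∀ a' ∈ 𝒜, a' ≠ a → M.KL a' < M.KL a := fun a' ha' hne =>
    hKL ▸ (Finset.le_sup' M.KL ha').lt_of_ne fun heq => hne (huniq a' ⟨ha', heq⟩)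
  rw [← hKL] at hD ⊢
  refine exists_tendsto_zero_le_ofReal ?_ fun η hη =>
    BanditQCD.eventually_worstCaseDelay_le hsub ha hD hmax hb hW hWb hA hη
  filter_upwards [hb.eventually_gt_atTop 0] with i hi
  exact div_pos hi hD

theorem theorem2 {K : ℕ} {𝓧 : Type*} [MeasurableSpace 𝓧] (M : BanditQCD K 𝓧) (v : ℝ≥0)
    (hM : M.Regular v) :
    (∀ (W : ℕ) (A : ℕ → BanditQCD.Path K 𝓧 → Fin K) (γ : ℝ),
      1 ≤ W → M.IsUCBPolicy v W A → 0 < γ →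
        ENNReal.ofReal γ ≤ M.meanTimeToFalseAlarm (M.alarm A (Real.log γ))) ∧
    (∀ (𝒜 : Finset (Fin K)) (h𝒜 : 𝒜.Nonempty),
      (∃! a, a ∈ 𝒜 ∧ M.KL a = M.maxKL 𝒜 h𝒜) →
      ∀ {ι : Type*} (l : Filter ι) (γ : ι → ℝ) (W : ι → ℕ)
        (A : ι → ℕ → BanditQCD.Path K 𝓧 → Fin K),
        Tendsto γ l atTop → Tendsto W l atTop →
        ((fun i => (W i : ℝ)) =o[l] fun i => Real.log (γ i)) →
        (∀ i, M.IsUCBPolicy v (W i) (A i)) →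
        ∃ r : ι → ℝ, Tendsto r l (𝓝 0) ∧ ∀ᶠ i in l,
          M.worstCaseDelay 𝒜 (A i) (M.alarm (A i) (Real.log (γ i))) ≤
            ENNReal.ofReal (Real.log (γ i) / M.maxKL 𝒜 h𝒜 * (1 + r i))) := by
  obtain ⟨hfalse, hdelay⟩ := theorem2_general M
  refine ⟨fun W A γ _ hA hγ => ?_, ?_⟩
  · simpa only [Real.exp_log hγ] using hfalse A (Real.log γ) hA.isControlPolicy
  · exact fun 𝒜 h𝒜 huniq ι l γ W A hγ => hdelay v 𝒜 h𝒜
      (fun a _ => ⟨hM.ac a, hM.subGaussian a⟩) (huniq.exists.elim fun a h => h.2 ▸ hM.KL_pos a)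
      huniq l _ W A (Real.tendsto_log_atTop.comp hγ)
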